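/- There is a universal constant $C>0$ such that the following holds. Let $(\mathbb B,\|\cdot\|)$ be a real Banach space (if $\mathbb B$ is not separable, measurability of $\mathbb B$-valued maps is understood in the strong, Bochner sense), and let $P$ be a Borel probability measure on $\mathbb B$ with $\mathbb E_{W\sim P}\|W\|^2<\infty$. Put $$\theta=\mathbb E_{W\sim P}[W],\qquad V=\mathbb E_{W\sim P}\|W-\theta\|^2,\qquad \nu=\sup_{\|u\|_*\le 1}\mathbb E_{W\sim P}|\langle W-\theta,u\rangle|^2 .$$ Let $n\ge 1$, $N=2n$, and let $W_1,\dots,W_{2n}$ be i.i.d. with law $P$, split into $\mathcal S_1=(W_1,\dots,W_n)$ and $\mathcal S_2=(W_{n+1},\dots,W_{2n})$. Let the pilots $\hat\theta_{\mathcal S_1}$, $\hat\theta_{\mathcal S_2}$ be measurable functions of $\mathcal S_1$ and of $\mathcal S_2$ respectively, with values in $\mathbb B$. Let $\alpha\ge 1$, $R>0$, $r_n>0$, and let $U\subseteq\mathbb B$ contain the closed ball $B(\theta,r_n)=\{x:\|x-\theta\|\le r_n\}$. Let $f:\mathbb B\to\mathbb R$ be infinitely Fréchet differentiable at every point of $U$,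 with $$\|f\|_{\mathcal G^\alpha(U),R}:=\sup_{x\in U}\sup_{k\ge 0}\frac{\|\mathcal D^kf(x)\|_{\rm S}}{R^k(k!)^\alpha}<\infty ,$$ where $\|\cdot\|_{\rm S}$ is the operator norm of multilinear forms (so $f$ is in the Gevrey class $\mathcal G^\alpha(U)$). For a sample $\mathcal S=(w_1,\dots,w_n)$, $s\ge 0$ and $t\in\mathbb B$ set $$\widehat f_s(\mathcal S;t)=f(t)+\sum_{k=1}^{s}\frac1{k!}\binom nk^{-1}\sum_{1\le j_1<\dots<j_k\le n}\mathcal D^kf(t)[w_{j_1}-t,\dots,w_{j_k}-t],$$ and let $$\widehat f_s=\tfrac12\big(\widehat f_s(\mathcal S_1;\hat\theta_{\mathcal S_2})+\widehat f_s(\mathcal S_2;\hat\theta_{\mathcal S_1})\big),\qquad s=\lfloor\log(en)\rfloor .$$ Let $\bar W_N=N^{-1}\sum_{i=1}^N W_i$ and $\mathcal E=\{\max(\|\hat\theta_{\mathcal S_1}-\theta\|,\|\hat\theta_{\mathcal S_2}-\theta\|)\le r_n\}$. If $$R\,r_n\log^{\alpha-1}(en)\ \vee\ R\log^{\alpha}(en)\sqrt{V/n}\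 \le\ e^{-1},$$ then both expectations below are finite and $$\mathbb E^{1/2}\Big[|\widehat f_s-f(\theta)|^2\mathbf 1_{\mathcal E}\Big]\le C\,2^\alpha(R\vee R^2)\,\|f\|_{\mathcal G^\alpha(U),R}\Big(\sqrt{\frac{\nu}{n}}+\frac{r_n}{n}\Big),$$ $$\mathbb E^{1/2}\Big[N\big(\widehat f_s-f(\theta)-\mathcal D^1f(\theta)[\bar W_N-\theta]\big)^2\mathbf 1_{\mathcal E}\Big]\le C\,2^\alpha(R\vee R^2)\,\|f\|_{\mathcal G^\alpha(U),R}\Big(\sqrt{\frac{\nu V}{n}}+\frac{r_n}{\sqrt n}+\frac{\sqrt\nu}{n^{3/4}}\Big).$$ -/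

import Mathlib

open MeasureTheory ProbabilityTheory

noncomputable section

namespace GevreyEst

/-- The mean `θ(P) = E_{W ∼ P}[W]`, a Bochner integral. -/
def mean {B : Type*} [NormedAddCommGroup B] [NormedSpace ℝ B] [MeasurableSpace B]
    (P : Measure B) : B :=
  ∫ w, w ∂P

/-- The strong variance `V(P) = E ‖W - θ(P)‖²`. -/
def strongVar {B : Type*} [NormedAddCommGroup B] [NormedSpace ℝ B] [MeasurableSpace B]
    (P : Measure B) : ℝ :=
  ∫ w, ‖w - mean P‖ ^ 2 ∂P

/-- The weak variance `ν(P) = sup_{‖u‖_* ≤ 1} E |⟨W - θ(P), u⟩|²`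
(a supremum of a set of reals bounded by `V(P)` when `P` has a finite second moment). -/
def weakVar {B : Type*} [NormedAddCommGroup B] [NormedSpace ℝ B] [MeasurableSpace B]
    (P : Measure B) : ℝ :=
  ⨆ u : {u : StrongDual ℝ B // ‖u‖ ≤ 1}, ∫ w, |u.1 (w - mean P)| ^ 2 ∂P

/-- The Gevrey semi-norm `sup_{x ∈ U} sup_{k ≥ 0} ‖D^k f(x)‖ / (R^k (k!)^α)`, with values
in `[0, ∞]`. -/
def gevreyNorm {B : Type*} [NormedAddCommGroup B] [NormedSpace ℝ B]
    (α R : ℝ) (U : Set B) (f : B → ℝ) : ENNReal :=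
  ⨆ x ∈ U, ⨆ k : ℕ,
    ENNReal.ofReal (‖iteratedFDeriv ℝ k f x‖ / (R ^ k * (k.factorial : ℝ) ^ α))

/-- `f` is infinitely Fréchet differentiable at each point of `U` (for open `U` this is
`ContDiffOn ℝ ∞ f U`); the values of `f` away from `U` are arbitrary. -/
def SmoothOn {B : Type*} [NormedAddCommGroup B] [NormedSpace ℝ B]
    (U : Set B) (f : B → ℝ) : Prop :=
  ∀ x ∈ U, ContDiffAt ℝ ((⊤ : ℕ∞) : WithTop ℕ∞) f x

/-- The Gevrey class of order `α` on `U`. -/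
def gevreyClass {B : Type*} [NormedAddCommGroup B] [NormedSpace ℝ B]
    (α : ℝ) (U : Set B) : Set (B → ℝ) :=
  {f | SmoothOn U f ∧ ∃ R : ℝ, 0 < R ∧ gevreyNorm α R U f < ⊤}

/-- `T[Ū^{(k)}(b)]`: the average of `T[w_{j₁} - b, …, w_{j_k} - b]` over all
`j₁ < ⋯ < j_k`, for a sample `w` of size `n`. -/
def uStat {B : Type*} [NormedAddCommGroup B] [NormedSpace ℝ B] {n k : ℕ}
    (T : ContinuousMultilinearMap ℝ (fun _ : Fin k => B) ℝ) (w : Fin n → B) (b : B) : ℝ :=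
  ((n.choose k : ℕ) : ℝ)⁻¹ * ∑ j : Fin k ↪o Fin n, T (fun i => w (j i) - b)

/-- The one-sided estimator with U-statistics computed from the sample `w` and
pilot value `t`: `f(t) + ∑_{k=1}^s D^k f(t)[Ū^{(k)}(t)] / k!`. -/
def oneSided {B : Type*} [NormedAddCommGroup B] [NormedSpace ℝ B] {n : ℕ}
    (f : B → ℝ) (s : ℕ) (w : Fin n → B) (t : B) : ℝ :=
  f t + ∑ k ∈ Finset.Icc 1 s, uStat (iteratedFDeriv ℝ k f t) w t / (k.factorial : ℝ)

/-- First half `(w₁, …, w_n)` of a sample of size `2n`. -/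
def firstHalf {B : Type*} {n : ℕ} (w : Fin (n + n) → B) : Fin n → B :=
  fun i => w (Fin.castAdd n i)

/-- Second half `(w_{n+1}, …, w_{2n})` of a sample of size `2n`. -/
def secondHalf {B : Type*} {n : ℕ} (w : Fin (n + n) → B) : Fin n → B :=
  fun i => w (Fin.natAdd n i)

/-- The cross-fitted estimator, with pilot `g₁` computed from the first half and pilot `g₂`
computed from the second half. -/
def crossFit {B : Type*} [NormedAddCommGroup B] [NormedSpace ℝ B] {n : ℕ}
    (f : B → ℝ) (s : ℕ) (g₁ g₂ : (Fin n → B) → B) (w : Fin (n + n) → B) : ℝ :=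
  (oneSided f s (firstHalf w) (g₂ (secondHalf w)) +
    oneSided f s (secondHalf w) (g₁ (firstHalf w))) / 2

/-- The full sample average. -/
def sampleMean {B : Type*} [NormedAddCommGroup B] [NormedSpace ℝ B] {N : ℕ}
    (w : Fin N → B) : B :=
  (N : ℝ)⁻¹ • ∑ i, w i

/-- The truncation level `⌊log(en)⌋`. -/
def truncLevel (n : ℕ) : ℕ := ⌊Real.log (Real.exp 1 * n)⌋₊

/-- The event that both pilots are within distance `r` of `θ`. -/
def pilotEvent {Ω B : Type*} [NormedAddCommGroup B] {n : ℕ}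
    (g₁ g₂ : (Fin n → B) → B) (W : Fin (n + n) → Ω → B) (θ : B) (r : ℝ) : Set Ω :=
  {ω | max ‖g₁ (firstHalf fun i => W i ω) - θ‖ ‖g₂ (secondHalf fun i => W i ω) - θ‖ ≤ r}

end GevreyEst

end

namespace GevreyEst

/-! Condition on the pilot: by independence of the two halves it becomes a fixed point `t` of the
ball of radius `r` around `θ`, and the U-statistics are those of a fresh i.i.d. sample. Derivatives
of `f` at `t` are symmetric, so each `D^k f(t)[w - t, …]` can be re-expanded around `θ` by writing
`w - t = (w - θ) + (θ - t)`. After regrouping, the one-sided estimator is the sum over `l ≤ s` of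
`1/l!` times a U-statistic centered at `θ`, whose kernel `taylorForm` is the Taylor expansion from
`t` of `D^l f(θ)` (`oneSided_eq_sum_uStat`).

The order-zero term is deterministic, and differs from `f(θ)` by a Taylor remainder. The Gevrey
bound and the choice `s = ⌊log(en)⌋` make this remainder geometric of ratio `1/e`, hence of size
`r/n` (`abs_bias_le`).

For `l ≥ 1` the kernels are evaluated at centered independent variables, so distinct terms of a
U-statistic are orthogonal. Each term has second moment at most `‖G‖² ν V^(l-1)`: one argument is
integrated as a linear functional and costs the weak variance, the others cost the strong one.
Dividing by `C(n, l)` (`integral_uStat_sq_le`) and using the hypothesis on `V` leaves a convergent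
geometric series led by `√(ν/n)`.

For the linearization error the kernel of order one is replaced by its difference with `D f(θ)`.
This is again a Taylor remainder, of size about `log(en)/n`, and the series then starts at order
two, with leading size `√(νV)/n`.

These bounds are uniform in `t`, so Fubini on the product of the two half-sample laws and the
triangle inequality for the two symmetric halves give the theorem (`eLpNorm_crossFit_le`). -/

/-- Invariance of a multilinear form under permutation of its arguments. -/
def IsSymm {B : Type*} [NormedAddCommGroup B] [NormedSpace ℝ B] {k : ℕ}
    (T : ContinuousMultilinearMap ℝ (fun _ : Fin k => B) ℝ) : Prop :=
  ∀ (σ : Equiv.Perm (Fin k)) (v : Fin k → B), T (v ∘ σ) = T v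

/-! ### Symmetry of higher derivatives -/

section Symmetry

variable {B : Type*} [NormedAddCommGroup B] [NormedSpace ℝ B]

/-- Invariance under adjacent transpositions suffices for symmetry. -/
lemma isSymm_of_swap {k : ℕ} {T : ContinuousMultilinearMap ℝ (fun _ : Fin (k + 1) => B) ℝ}
    (hT : ∀ (i : Fin k) (v : Fin (k + 1) → B),
      T (v ∘ Equiv.swap i.castSucc i.succ) = T v) : IsSymm T := by
  intro σ
  have hσ : σ ∈ Submonoid.closure
      (Set.range fun i : Fin k => Equiv.swap i.castSucc i.succ) := by
    rw [Equiv.Perm.mclosure_swap_castSucc_succ]; trivial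
  induction hσ using Submonoid.closure_induction with
  | mem x hx =>
    obtain ⟨i, rfl⟩ := hx
    exact hT i
  | one => intro v; rfl
  | mul x y _ _ hx hy =>
    intro v
    rw [Equiv.Perm.coe_mul, ← Function.comp_assoc, hy, hx]

/-- The iterated derivatives of a `C^k` function are symmetric. -/
lemma isSymm_iteratedFDeriv (k : ℕ) {f : B → ℝ} {x : B} (hf : ContDiffAt ℝ k f x) :
    IsSymm (iteratedFDeriv ℝ k f x) := by
  induction k generalizing x with
  | zero =>
    intro σ v
    congr 1
    exact Subsingleton.elim _ _
  | succ k ih =>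
    have hd : DifferentiableAt ℝ (iteratedFDeriv ℝ k f) x :=
      hf.differentiableAt_iteratedFDeriv (by exact_mod_cast Nat.lt_succ_self k)
    refine isSymm_of_swap fun i v => ?_
    cases k with
    | zero => exact i.elim0
    | succ k =>
      cases i using Fin.cases with
      -- Exchanging the first two arguments is the symmetry of the second derivative of `D^k f`.
      | zero =>
        have hsymm : IsSymmSndFDerivAt ℝ (iteratedFDeriv ℝ k f) x :=
          ContDiffAt.isSymmSndFDerivAt (n := 2)
            (hf.iteratedFDeriv_right (by push_cast; rw [add_assoc, one_add_one_eq_two, add_comm]))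
            (by simp)
        have key : ∀ v : Fin (k + 1 + 1) → B, iteratedFDeriv ℝ (k + 1 + 1) f x v =
            fderiv ℝ (fderiv ℝ (iteratedFDeriv ℝ k f)) x (v 0) (v 1) (Fin.tail (Fin.tail v)) := by
          intro v
          have hdd : DifferentiableAt ℝ (fderiv ℝ (iteratedFDeriv ℝ k f)) x :=
            (ContDiffAt.fderiv_right (m := 1) (n := 2)
              (hf.iteratedFDeriv_right
                (by push_cast; rw [add_assoc, one_add_one_eq_two, add_comm]))
              (by norm_num)).differentiableAt (by simp)
          rw [hd.iteratedFDeriv_succ_apply_left']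
          have hda : DifferentiableAt ℝ (fun y => fderiv ℝ (iteratedFDeriv ℝ k f) y (v 1)) x :=
            hdd.clm_apply (differentiableAt_const _)
          have e1 := fderiv_continuousMultilinear_apply_const_apply hda
            (Fin.tail (Fin.tail v)) (v 0)
          rw [fderiv_clm_apply hdd (differentiableAt_const _)] at e1
          refine Eq.trans ?_ (e1.trans (by simp))
          rfl
        rw [key, key, hsymm.eq]
        have h2 : Fin.tail (Fin.tail (v ∘ Equiv.swap (0 : Fin (k + 1)).castSucc
            (0 : Fin (k + 1)).succ)) = Fin.tail (Fin.tail v) := by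
          funext j
          simp only [Fin.tail, Function.comp]
          rw [Equiv.swap_apply_of_ne_of_ne]
          · simp
          · simp [Fin.ext_iff]
        rw [h2]
        simp
      -- A later exchange does not touch the first argument: it is the derivative, in that
      -- direction, of the symmetry of order `k + 1`, which by induction holds at all nearby points.
      | succ i =>
        rw [hd.iteratedFDeriv_succ_apply_left', hd.iteratedFDeriv_succ_apply_left']
        have h0 : (v ∘ Equiv.swap i.succ.castSucc i.succ.succ) 0 = v 0 := by
          simp only [Function.comp]
          rw [Equiv.swap_apply_of_ne_of_ne] <;> simp [Fin.ext_iff]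
        have h1 : Fin.tail (v ∘ Equiv.swap i.succ.castSucc i.succ.succ) =
            Fin.tail v ∘ Equiv.swap i.castSucc i.succ := by
          funext j
          simp only [Fin.tail, Function.comp]
          rw [← Fin.succ_castSucc, ← Function.Injective.swap_apply (Fin.succ_injective _)]
        rw [h0, h1]
        congr 1
        refine Filter.EventuallyEq.fderiv_eq ?_
        filter_upwards [(hf.of_le (m := (k + 1 : ℕ)) (by norm_cast; omega)).eventually
          (by simp)] with y hy
        exact ih hy _ _

end Symmetry

lemma append_update_right {X : Type*} {l m : ℕ} [DecidableEq (Fin l)] (u : Fin m → X)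
    (v : Fin l → X) (i : Fin l) (z : X) : Fin.append u (Function.update v i z) =
      Function.update (Fin.append u v) (Fin.natAdd m i) z := by
  funext j
  refine Fin.addCases (fun p => ?_) (fun p => ?_) j
  · rw [Function.update_of_ne (by simp [Fin.ext_iff]; omega)]; simp
  · by_cases hp : p = i
    · subst hp; simp
    · rw [Function.update_of_ne (by simpa [Fin.ext_iff] using hp)]; simp [hp]

/-! ### U-statistics: symmetrization and recentering -/

section UStatistics

variable {B : Type*} [NormedAddCommGroup B] [NormedSpace ℝ B] {n k : ℕ}

lemma card_orderEmb (k n : ℕ) : Fintype.card (Fin k ↪o Fin n) = n.choose k := by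
  rw [← Nat.card_eq_fintype_card, Nat.card_congr Set.powersetCard.ofFinEmbEquiv,
    Set.powersetCard.card, Nat.card_fin]

lemma exists_perm_comp_eq {j j' : Fin k → Fin n} (hj : j.Injective) (hj' : j'.Injective)
    (h : Set.range j = Set.range j') : ∃ π : Equiv.Perm (Fin k), j = j' ∘ π := by
  refine ⟨((Equiv.ofInjective j hj).trans (Equiv.setCongr h)).trans
    (Equiv.ofInjective j' hj').symm, ?_⟩
  funext i
  have := Equiv.apply_ofInjective_symm hj' (((Equiv.ofInjective j hj).trans (Equiv.setCongr h)) i)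
  simpa using this.symm

/-- The order embedding with the same range as a given embedding. -/
noncomputable def sortEmb (j : Fin k ↪ Fin n) : Fin k ↪o Fin n :=
  (Finset.univ.map j).orderEmbOfFin (by simp)

lemma range_sortEmb (j : Fin k ↪ Fin n) : Set.range (sortEmb j) = Set.range j := by
  simp [sortEmb]

lemma orderEmb_ext_range {j j' : Fin k ↪o Fin n} (h : Set.range j = Set.range j') : j = j' := by
  refine Set.powersetCard.ofFinEmbEquiv.injective (Subtype.ext (Finset.coe_injective ?_))
  ext i
  have := Set.ext_iff.1 h i
  rwa [← Set.powersetCard.mem_ofFinEmbEquiv_iff_mem_range,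
    ← Set.powersetCard.mem_ofFinEmbEquiv_iff_mem_range] at this

/-- U-statistics with a symmetric kernel do not depend on the order of the sample. -/
lemma uStat_comp_perm {T : ContinuousMultilinearMap ℝ (fun _ : Fin k => B) ℝ} (hT : IsSymm T)
    (w : Fin n → B) (b : B) (σ : Equiv.Perm (Fin n)) : uStat T (w ∘ σ) b = uStat T w b := by
  unfold uStat
  congr 1
  -- Sorting `σ ∘ j` permutes the set of increasing index tuples, and the symmetric kernel does not
  -- see the sorting.
  have hinj : Function.Injective
      fun j : Fin k ↪o Fin n => sortEmb (j.toEmbedding.trans σ.toEmbedding) := by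
    intro j j' h
    refine orderEmb_ext_range (σ.injective.image_injective ?_)
    have h1 := range_sortEmb (j.toEmbedding.trans σ.toEmbedding)
    rw [show sortEmb (j.toEmbedding.trans σ.toEmbedding) = _ from h, range_sortEmb] at h1
    rw [← Set.range_comp, ← Set.range_comp]
    exact h1.symm
  refine Fintype.sum_bijective _ (Finite.injective_iff_bijective.1 hinj) _ _ fun j => ?_
  obtain ⟨π, hπ⟩ := exists_perm_comp_eq (j.toEmbedding.trans σ.toEmbedding).injective
    (sortEmb (j.toEmbedding.trans σ.toEmbedding)).injective (range_sortEmb _).symm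
  rw [← hT π (fun i => w (sortEmb (j.toEmbedding.trans σ.toEmbedding) i) - b)]
  congr 1
  funext i
  have := congrFun hπ i
  simp only [Function.Embedding.trans_apply, Function.comp] at this ⊢
  rw [← this]
  rfl

/-- Some permutation `τ` carries `e'` to `e`, and `σ ↦ στ` reindexes the sum. -/
lemma sum_perm_comp_emb (φ : (Fin k → Fin n) → ℝ) (e e' : Fin k ↪ Fin n) :
    ∑ σ : Equiv.Perm (Fin n), φ (σ ∘ e) = ∑ σ : Equiv.Perm (Fin n), φ (σ ∘ e') := by
  obtain ⟨τ, hτ⟩ := Equiv.Perm.exists_extending_pair e' e e'.injective e.injective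
  refine Fintype.sum_bijective (fun σ => σ * τ) (Group.mulRight_bijective τ) _ _ fun σ => ?_
  congr 1
  funext i
  simp [hτ]

/-- A U-statistic with a symmetric kernel is an average over all permutations of the sample. -/
lemma uStat_eq_average {T : ContinuousMultilinearMap ℝ (fun _ : Fin k => B) ℝ} (hT : IsSymm T)
    (w : Fin n → B) (b : B) (e : Fin k ↪ Fin n) :
    uStat T w b = ((n.factorial : ℕ) : ℝ)⁻¹ *
      ∑ σ : Equiv.Perm (Fin n), T (fun i => w (σ (e i)) - b) := by
  have hk : k ≤ n := by simpa using Fintype.card_le_of_embedding e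
  have hc : ((n.choose k : ℕ) : ℝ) ≠ 0 := by exact_mod_cast (Nat.choose_pos hk).ne'
  have hn : ((n.factorial : ℕ) : ℝ) ≠ 0 := by exact_mod_cast n.factorial_ne_zero
  -- The sum over all reorderings of the sample is computed twice: by invariance, and by exchanging
  -- sums, where every increasing tuple contributes as much as `e`.
  have h1 : ∑ σ : Equiv.Perm (Fin n), uStat T (w ∘ σ) b = n.factorial * uStat T w b := by
    simp [uStat_comp_perm hT, Fintype.card_perm]
  have h2 : ∑ σ : Equiv.Perm (Fin n), uStat T (w ∘ σ) b =
      ∑ σ : Equiv.Perm (Fin n), T (fun i => w (σ (e i)) - b) := by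
    simp only [uStat, ← Finset.mul_sum]
    rw [Finset.sum_comm]
    have : ∀ j : Fin k ↪o Fin n, ∑ σ : Equiv.Perm (Fin n), T (fun i => (w ∘ σ) (j i) - b) =
        ∑ σ : Equiv.Perm (Fin n), T (fun i => w (σ (e i)) - b) := fun j =>
      sum_perm_comp_emb (fun a => T (fun i => w (a i) - b)) j.toEmbedding e
    simp only [this]
    rw [Finset.sum_const, Finset.card_univ, card_orderEmb, nsmul_eq_mul, inv_mul_cancel_left₀ hc]
  rw [← h2, h1, inv_mul_cancel_left₀ hn]

/-- `T[h, …, h, ·]`, with the first `m` arguments of `T` set to `h`. -/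
noncomputable def fixFirst {l m : ℕ} (h : B)
    (T : ContinuousMultilinearMap ℝ (fun _ : Fin (m + l) => B) ℝ) :
    ContinuousMultilinearMap ℝ (fun _ : Fin l => B) ℝ :=
  MultilinearMap.mkContinuous
    { toFun := fun v => T (Fin.append (fun _ : Fin m => h) v)
      map_update_add' := by
        intro _ v i x y
        simp only [append_update_right, T.map_update_add]
      map_update_smul' := by
        intro _ v i c x
        simp only [append_update_right, T.map_update_smul] }
    (‖T‖ * ‖h‖ ^ m) (fun v => by
      refine (T.le_opNorm _).trans (le_of_eq ?_)
      rw [Fin.prod_univ_add]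
      simp [mul_assoc])

lemma fixFirst_apply {l m : ℕ} (h : B)
    (T : ContinuousMultilinearMap ℝ (fun _ : Fin (m + l) => B) ℝ) (v : Fin l → B) :
    fixFirst h T v = T (Fin.append (fun _ : Fin m => h) v) := rfl

lemma norm_fixFirst_le {l m : ℕ} (h : B)
    (T : ContinuousMultilinearMap ℝ (fun _ : Fin (m + l) => B) ℝ) :
    ‖fixFirst h T‖ ≤ ‖T‖ * ‖h‖ ^ m :=
  MultilinearMap.mkContinuous_norm_le _ (by positivity) _

lemma isSymm_fixFirst {l m : ℕ} {T : ContinuousMultilinearMap ℝ (fun _ : Fin (m + l) => B) ℝ}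
    (hT : IsSymm T) (h : B) : IsSymm (fixFirst h T) := by
  intro σ v
  rw [fixFirst_apply, fixFirst_apply,
    ← hT (finSumFinEquiv.symm.trans ((Equiv.sumCongr (Equiv.refl (Fin m)) σ).trans
      finSumFinEquiv)) (Fin.append (fun _ : Fin m => h) v)]
  congr 1
  funext j
  refine Fin.addCases (fun p => ?_) (fun p => ?_) j <;> simp

lemma exists_perm_of_card {l m : ℕ} (S : Finset (Fin (m + l))) (hS : S.card = l) :
    ∃ π : Equiv.Perm (Fin (m + l)),
      (∀ i, π (Fin.castAdd l i) ∉ S) ∧ ∀ i, π (Fin.natAdd m i) ∈ S := by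
  obtain ⟨σ, hσ⟩ := Equiv.Perm.exists_map_finset_eq
    (Finset.univ.map (Fin.natAddEmb m : Fin l ↪ Fin (m + l))) S (by simp [hS])
  refine ⟨σ, fun i hi => ?_, fun i => ?_⟩
  · rw [← hσ] at hi
    simp [Fin.ext_iff] at hi
    omega
  · rw [← hσ]
    simp

/-- Symmetry moves the positions in `S` to the end, and the sum over `σ` forgets which sample
indices they carry; hence only the cardinality of `S` matters. This is what produces binomial
coefficients in the recentering. -/
lemma IsSymm.sum_perm_piecewise {l m : ℕ}
    {T : ContinuousMultilinearMap ℝ (fun _ : Fin (m + l) => B) ℝ} (hT : IsSymm T)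
    (x : Fin n → B) (h : B) (e : Fin (m + l) ↪ Fin n) (e' : Fin l ↪ Fin n)
    (S : Finset (Fin (m + l))) (hS : S.card = l) :
    ∑ σ : Equiv.Perm (Fin n), T (S.piecewise (fun i => x (σ (e i))) (fun _ => h)) =
      ∑ σ : Equiv.Perm (Fin n), fixFirst h T (fun i => x (σ (e' i))) := by
  obtain ⟨π, h1, h2⟩ := exists_perm_of_card S hS
  refine Eq.trans ?_ (sum_perm_comp_emb (fun a => fixFirst h T (fun i => x (a i)))
    (((Fin.natAddEmb m : Fin l ↪ Fin (m + l)).trans π.toEmbedding).trans e) e')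
  refine Finset.sum_congr rfl fun σ _ => ?_
  rw [← hT π, fixFirst_apply]
  congr 1
  funext j
  refine Fin.addCases (fun p => ?_) (fun p => ?_) j
  · simp [h1 p]
  · simp [h2 p]

/-- Recentering of U-statistics: a binomial expansion for a family of symmetric kernels. -/
lemma uStat_recenter {T : ∀ k : ℕ, ContinuousMultilinearMap ℝ (fun _ : Fin k => B) ℝ}
    (hT : ∀ k, IsSymm (T k)) (hk : k ≤ n) (w : Fin n → B) (t θ : B) :
    uStat (T k) w t = ∑ p ∈ Finset.HasAntidiagonal.antidiagonal k,
      (k.choose p.2 : ℝ) * uStat (fixFirst (l := p.2) (θ - t) (T (p.1 + p.2))) w θ := by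
  classical
  -- Multilinear expansion of `(w - θ) + (θ - t)`: `S` is the set of positions that keep a sample
  -- point, so `p.2` counts these and `p.1` those filled with `θ - t`.
  have hexp : ∀ σ : Equiv.Perm (Fin n), T k (fun i => w (σ (Fin.castLEEmb hk i)) - t) =
      ∑ S : Finset (Fin k), T k (S.piecewise (fun i => w (σ (Fin.castLEEmb hk i)) - θ)
        (fun _ => θ - t)) := by
    intro σ
    rw [← ContinuousMultilinearMap.map_add_univ]
    congr 1
    funext i
    simp
  rw [uStat_eq_average (hT k) w t (Fin.castLEEmb hk)]
  simp only [hexp]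
  rw [Finset.sum_comm, Finset.mul_sum, ← Finset.powerset_univ, Finset.sum_powerset,
    Finset.card_univ, Fintype.card_fin, Finset.Nat.sum_antidiagonal_eq_sum_range_succ_mk,
    ← Finset.sum_range_reflect]
  refine Finset.sum_congr rfl fun m hm => ?_
  have hm' : m ≤ k := by simpa [Nat.lt_succ_iff] using hm
  obtain ⟨l, rfl⟩ := Nat.exists_eq_add_of_le hm'
  have hl : l ≤ n := by omega
  have e1 : m + l + 1 - 1 - m = l := by omega
  have e2 : m + l - m = l := by omega
  simp only [e1]
  rw [e2]
  rw [uStat_eq_average (isSymm_fixFirst (hT _) _) w θ (Fin.castLEEmb hl)]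
  rw [Finset.sum_congr rfl fun S hS => by
    rw [(hT (m + l)).sum_perm_piecewise (fun i => w i - θ) (θ - t) (Fin.castLEEmb hk)
      (Fin.castLEEmb hl) S (Finset.mem_powersetCard.1 hS).2]]
  simp

end UStatistics

/-! ### Linearity of U-statistics in the kernel, and the lowest orders -/

section Linearity

variable {B : Type*} [NormedAddCommGroup B] [NormedSpace ℝ B] {n k : ℕ}

lemma uStat_sum {ι : Type*} (s : Finset ι)
    (T : ι → ContinuousMultilinearMap ℝ (fun _ : Fin k => B) ℝ) (w : Fin n → B) (b : B) :
    uStat (∑ i ∈ s, T i) w b = ∑ i ∈ s, uStat (T i) w b := by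
  simp only [uStat, sum_apply, ← Finset.mul_sum]
  rw [Finset.sum_comm]

lemma uStat_smul (c : ℝ) (T : ContinuousMultilinearMap ℝ (fun _ : Fin k => B) ℝ)
    (w : Fin n → B) (b : B) : uStat (c • T) w b = c * uStat T w b := by
  simp only [uStat, smul_apply, smul_eq_mul, ← Finset.mul_sum]
  ring

lemma uStat_sub (T T' : ContinuousMultilinearMap ℝ (fun _ : Fin k => B) ℝ)
    (w : Fin n → B) (b : B) : uStat (T - T') w b = uStat T w b - uStat T' w b := by
  simp only [uStat, sub_apply, Finset.sum_sub_distrib]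
  ring

lemma uStat_zero_degree (T : ContinuousMultilinearMap ℝ (fun _ : Fin 0 => B) ℝ)
    (w : Fin n → B) (b : B) : uStat T w b = T 0 := by
  have : ∀ v : Fin 0 → B, T v = T 0 := fun v => by congr 1; exact Subsingleton.elim _ _
  simp only [uStat, this, Finset.sum_const, Finset.card_univ, card_orderEmb]
  simp

lemma uStat_one_degree (hn : 1 ≤ n) (T : ContinuousMultilinearMap ℝ (fun _ : Fin 1 => B) ℝ)
    (w : Fin n → B) (b : B) : uStat T w b = T (fun _ => sampleMean w - b) := by
  set L : B →L[ℝ] ℝ := (ContinuousMultilinearMap.ofSubsingleton ℝ B ℝ (0 : Fin 1)).symm T with hL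
  have hTL : ∀ v : Fin 1 → B, T v = L (v 0) := by
    intro v
    rw [← (ContinuousMultilinearMap.ofSubsingleton ℝ B ℝ (0 : Fin 1)).apply_symm_apply T]
    rfl
  have hn' : (n : ℝ) ≠ 0 := by positivity
  have hbij : Function.Bijective fun j : Fin 1 ↪o Fin n => j 0 := by
    refine ⟨fun j j' h => ?_, fun i => ?_⟩
    · ext i
      rw [Subsingleton.elim i 0]
      exact congrArg _ h
    · exact ⟨OrderEmbedding.ofStrictMono (fun _ => i)
        (fun a b hab => absurd hab (by rw [Subsingleton.elim a b]; exact lt_irrefl b)), rfl⟩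
  have hsum : ∑ j : Fin 1 ↪o Fin n, T (fun i => w (j i) - b) = ∑ i, L (w i - b) :=
    Fintype.sum_bijective _ hbij _ _ fun j => hTL _
  rw [uStat, hsum, hTL]
  simp only [map_sub, sampleMean, map_smul, map_sum, Finset.sum_sub_distrib, Finset.sum_const,
    Finset.card_univ, Fintype.card_fin, Nat.choose_one_right, smul_eq_mul, nsmul_eq_mul]
  field_simp

end Linearity

/-! ### Taylor expansion of the derivatives along the segment from the pilot to the mean -/

section Taylor

variable {B : Type*} [NormedAddCommGroup B] [NormedSpace ℝ B] {n : ℕ}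

/-- The Taylor expansion to total order `s`, from `t` to `θ`, of the `l`-th derivative of `f`. -/
noncomputable def taylorForm (f : B → ℝ) (s : ℕ) (t θ : B) (l : ℕ) :
    ContinuousMultilinearMap ℝ (fun _ : Fin l => B) ℝ :=
  ∑ m ∈ Finset.range (s + 1 - l),
    ((m.factorial : ℝ)⁻¹) • fixFirst (θ - t) (iteratedFDeriv ℝ (m + l) f t)

/-- The one-sided estimator as a sum of U-statistics centered at `θ`. -/
lemma oneSided_eq_sum_uStat {f : B → ℝ} {s : ℕ} (hs : s ≤ n) {t : B}
    (hf : ContDiffAt ℝ ((⊤ : ℕ∞) : WithTop ℕ∞) f t) (w : Fin n → B) (θ : B) :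
    oneSided f s w t =
      ∑ l ∈ Finset.range (s + 1), uStat (taylorForm f s t θ l) w θ / (l.factorial : ℝ) := by
  have hsymm : ∀ k, IsSymm (iteratedFDeriv ℝ k f t) := fun k =>
    isSymm_iteratedFDeriv k (hf.of_le (by exact_mod_cast le_top))
  have h0 : oneSided f s w t =
      ∑ k ∈ Finset.range (s + 1), uStat (iteratedFDeriv ℝ k f t) w t / (k.factorial : ℝ) := by
    rw [Finset.sum_range_eq_add_Ico _ (Nat.succ_pos s), oneSided, uStat_zero_degree]
    simp
    rfl
  -- With `k = m + l`, the weight `C(k, l)/k!` splits as `1/(m! l!)`. Summing over `l` first instead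
  -- of `k` then collects all `m ≤ s - l` into `taylorForm`.
  let g : ℕ → ℕ → ℝ := fun l m => ((m.factorial : ℝ)⁻¹ * (l.factorial : ℝ)⁻¹) *
    uStat (fixFirst (l := l) (θ - t) (iteratedFDeriv ℝ (m + l) f t)) w θ
  have h1 : ∀ k ∈ Finset.range (s + 1),
      uStat (iteratedFDeriv ℝ k f t) w t / (k.factorial : ℝ) =
      ∑ i ∈ Finset.range (k + 1), g i (k - i) := by
    intro k hk
    have hk' : k ≤ n := by have := Finset.mem_range.1 hk; omega
    rw [uStat_recenter hsymm hk' w t θ, ← Finset.Nat.sum_antidiagonal_eq_sum_range_succ g,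
      ← Finset.Nat.sum_antidiagonal_swap (f := fun p => g p.1 p.2), Finset.sum_div]
    refine Finset.sum_congr rfl fun p hp => ?_
    have hp' : p.1 + p.2 = k := Finset.HasAntidiagonal.mem_antidiagonal.1 hp
    have hc : (k.choose p.2 : ℝ) * p.2.factorial * p.1.factorial = k.factorial := by
      have := Nat.choose_mul_factorial_mul_factorial (n := k) (k := p.2) (by omega)
      rw [show k - p.2 = p.1 by omega] at this
      exact_mod_cast this
    simp only [g, Prod.fst_swap, Prod.snd_swap]
    rw [← hc]
    have a1 : (p.1.factorial : ℝ) ≠ 0 := by exact_mod_cast p.1.factorial_ne_zero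
    have a2 : (p.2.factorial : ℝ) ≠ 0 := by exact_mod_cast p.2.factorial_ne_zero
    have a3 : (k.choose p.2 : ℝ) ≠ 0 := by
      exact_mod_cast (Nat.choose_pos (show p.2 ≤ k by omega)).ne'
    field_simp
  rw [h0, Finset.sum_congr rfl h1, Finset.sum_range_diag_flip (s + 1) g]
  refine Finset.sum_congr rfl fun l _ => ?_
  rw [taylorForm, uStat_sum, Finset.sum_div]
  refine Finset.sum_congr rfl fun m _ => ?_
  rw [uStat_smul]
  simp only [g]
  ring

/-- Taylor's inequality on `[0, 1]` for a sequence of successive derivatives. -/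
lemma abs_sub_taylor_le {ψ : ℕ → ℝ → ℝ} {N : ℕ} {M : ℝ}
    (hψ : ∀ m ≤ N, ∀ u ∈ Set.Icc (0 : ℝ) 1, HasDerivAt (ψ m) (ψ (m + 1) u) u)
    (hM : ∀ u ∈ Set.Icc (0 : ℝ) 1, |ψ (N + 1) u| ≤ M) :
    |ψ 0 1 - ∑ m ∈ Finset.range (N + 1), ψ m 0 / (m.factorial : ℝ)| ≤
      M / ((N + 1).factorial : ℝ) := by
  -- The Taylor polynomial from `u` to `1`: it equals `ψ 0 1` at `u = 1` and the Taylor sum at `u =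
  -- 0`, and its derivative telescopes to the single top term. That derivative is then compared with
  -- the one of `M/(N+1)! · (1 - (1-u)^(N+1))`.
  set g : ℝ → ℝ := fun u =>
    ∑ m ∈ Finset.range (N + 1), ψ m u * (1 - u) ^ m / (m.factorial : ℝ) with hg
  have hpow : ∀ (m : ℕ) (u : ℝ),
      HasDerivAt (fun u : ℝ => (1 - u) ^ (m + 1)) (-((m + 1 : ℝ) * (1 - u) ^ m)) u := by
    intro m u
    have := ((hasDerivAt_id u).const_sub 1).pow (m + 1)
    refine HasDerivAt.congr_deriv (f := fun u : ℝ => (1 - u) ^ (m + 1)) this (by simp)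
  have hderiv : ∀ u ∈ Set.Icc (0 : ℝ) 1,
      HasDerivAt g (ψ (N + 1) u * (1 - u) ^ N / (N.factorial : ℝ)) u := by
    intro u hu
    have key : ∀ K ≤ N, HasDerivAt (fun u =>
        ∑ m ∈ Finset.range (K + 1), ψ m u * (1 - u) ^ m / (m.factorial : ℝ))
        (ψ (K + 1) u * (1 - u) ^ K / (K.factorial : ℝ)) u := by
      intro K
      induction K with
      | zero => intro _; simpa using hψ 0 (Nat.zero_le _) u hu
      | succ K ih =>
        intro hK
        have h1 := ih (by omega)
        have h2 := ((hψ (K + 1) hK u hu).mul (hpow K u)).div_const ((K + 1).factorial : ℝ)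
        have h3 := h1.add h2
        simp only [Finset.sum_range_succ _ (K + 1)]
        refine h3.congr_deriv ?_
        have a1 : (K.factorial : ℝ) ≠ 0 := by exact_mod_cast K.factorial_ne_zero
        have a2 : (K : ℝ) + 1 ≠ 0 := by positivity
        rw [Nat.factorial_succ]
        push_cast
        field_simp
        ring
    exact key N le_rfl
  have hB : ∀ u : ℝ, HasDerivAt
      (fun u : ℝ => M / ((N + 1).factorial : ℝ) * (1 - (1 - u) ^ (N + 1)))
      (M * (1 - u) ^ N / (N.factorial : ℝ)) u := by
    intro u
    refine (((hpow N u).const_sub 1).const_mul (M / ((N + 1).factorial : ℝ))).congr_deriv ?_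
    have a1 : (N.factorial : ℝ) ≠ 0 := by exact_mod_cast N.factorial_ne_zero
    have a2 : (N : ℝ) + 1 ≠ 0 := by positivity
    rw [Nat.factorial_succ]
    push_cast
    field_simp
  have main := image_norm_le_of_norm_deriv_right_le_deriv_boundary (f := fun u => g u - g 0)
    (a := 0) (b := 1)
    (fun u hu => ((hderiv u hu).sub_const (g 0)).continuousAt.continuousWithinAt)
    (fun u hu => ((hderiv u (Set.Ico_subset_Icc_self hu)).sub_const (g 0)).hasDerivWithinAt)
    (by simp) hB (fun u hu => by
      have hu' : 0 ≤ 1 - u := by linarith [hu.2]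
      rw [Real.norm_eq_abs, abs_div, abs_mul, abs_of_nonneg (pow_nonneg hu' N), Nat.abs_cast]
      gcongr
      exact hM u (Set.Ico_subset_Icc_self hu))
    (Set.right_mem_Icc.2 zero_le_one)
  have g1 : g 1 = ψ 0 1 := by
    simp only [hg]
    rw [Finset.sum_range_succ', Finset.sum_eq_zero (by intro m _; simp)]
    simp
  have g0 : g 0 = ∑ m ∈ Finset.range (N + 1), ψ m 0 / (m.factorial : ℝ) := by simp [hg]
  rw [Real.norm_eq_abs, g1, g0] at main
  simpa using main

lemma iteratedFDeriv_cast {a b : ℕ} (h : a = b) (f : B → ℝ) (x : B) (v : Fin b → B) :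
    iteratedFDeriv ℝ a f x (v ∘ Fin.cast h) = iteratedFDeriv ℝ b f x v := by
  subst h; rfl

lemma hasDerivAt_iteratedFDeriv_line {f : B → ℝ} {t h : B} {u : ℝ} {l m : ℕ}
    (hf : ContDiffAt ℝ ((⊤ : ℕ∞) : WithTop ℕ∞) f (t + u • h)) (v : Fin l → B) :
    HasDerivAt (fun u : ℝ => iteratedFDeriv ℝ (m + l) f (t + u • h)
        (Fin.append (fun _ : Fin m => h) v))
      (iteratedFDeriv ℝ (m + 1 + l) f (t + u • h)
        (Fin.append (fun _ : Fin (m + 1) => h) v)) u := by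
  have hd : DifferentiableAt ℝ (iteratedFDeriv ℝ (m + l) f) (t + u • h) :=
    hf.differentiableAt_iteratedFDeriv (by exact_mod_cast ENat.natCast_lt_top _)
  have hline : HasDerivAt (fun u : ℝ => t + u • h) h u := by
    simpa using ((hasDerivAt_id u).smul_const h).const_add t
  have h1 := (hd.hasFDerivAt.continuousMultilinear_apply_const
    (Fin.append (fun _ : Fin m => h) v)).comp_hasDerivAt u hline
  refine h1.congr_deriv (Eq.symm ?_)
  have hcons : (fun _ : Fin (m + 1) => h) = Fin.cons h (fun _ : Fin m => h) := by
    funext i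
    refine Fin.cases ?_ (fun j => ?_) i <;> simp
  rw [hcons, Fin.append_cons, iteratedFDeriv_cast, iteratedFDeriv_succ_apply_left]
  rfl

/-- Taylor's inequality for the `l`-th derivative. -/
lemma norm_iteratedFDeriv_sub_taylorForm_le {f : B → ℝ} {t θ : B} {s l : ℕ} (hl : l ≤ s)
    {K : ℝ} (hK : 0 ≤ K)
    (hf : ∀ x ∈ segment ℝ t θ, ContDiffAt ℝ ((⊤ : ℕ∞) : WithTop ℕ∞) f x)
    (hb : ∀ x ∈ segment ℝ t θ, ‖iteratedFDeriv ℝ (s + 1) f x‖ ≤ K) :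
    ‖iteratedFDeriv ℝ l f θ - taylorForm f s t θ l‖ ≤
      K * ‖θ - t‖ ^ (s + 1 - l) / ((s + 1 - l).factorial : ℝ) := by
  refine ContinuousMultilinearMap.opNorm_le_bound (by positivity) fun v => ?_
  have hseg : ∀ u ∈ Set.Icc (0 : ℝ) 1, t + u • (θ - t) ∈ segment ℝ t θ := by
    intro u hu
    rw [segment_eq_image']
    exact ⟨u, hu, rfl⟩
  obtain ⟨N, rfl⟩ := Nat.exists_eq_add_of_le' hl
  have e1 : N + l + 1 - l = N + 1 := by omega
  -- For fixed `v` the statement is one-dimensional: each derivative in `u` inserts one more copy of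
  -- `θ - t` into the form.
  have key := abs_sub_taylor_le (N := N) (M := K * ‖θ - t‖ ^ (N + 1) * ∏ i, ‖v i‖)
    (ψ := fun m u => iteratedFDeriv ℝ (m + l) f (t + u • (θ - t))
      (Fin.append (fun _ : Fin m => θ - t) v))
    (fun m _ u hu => hasDerivAt_iteratedFDeriv_line (hf _ (hseg u hu)) v)
    (fun u hu => by
      rw [← Real.norm_eq_abs]
      refine (ContinuousMultilinearMap.le_opNorm _ _).trans ?_
      rw [Fin.prod_univ_add]
      simp only [Fin.append_left, Fin.append_right, Finset.prod_const, Finset.card_univ,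
        Fintype.card_fin]
      have := hb _ (hseg u hu)
      rw [show N + l + 1 = N + 1 + l by omega] at this
      rw [mul_assoc]
      gcongr)
  rw [e1]
  have e2 : (iteratedFDeriv ℝ l f θ - taylorForm f (N + l) t θ l) v =
      iteratedFDeriv ℝ (0 + l) f (t + (1 : ℝ) • (θ - t)) (Fin.append (fun _ : Fin 0 => θ - t) v) -
      ∑ m ∈ Finset.range (N + 1), iteratedFDeriv ℝ (m + l) f (t + (0 : ℝ) • (θ - t))
        (Fin.append (fun _ : Fin m => θ - t) v) / (m.factorial : ℝ) := by
    rw [sub_apply, taylorForm, e1, sum_apply]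
    congr 1
    · rw [Fin.append_left_nil _ _ rfl, iteratedFDeriv_cast]
      simp
    · refine Finset.sum_congr rfl fun m _ => ?_
      rw [smul_apply, fixFirst_apply, zero_smul, add_zero, smul_eq_mul]
      ring
  rw [e2, Real.norm_eq_abs]
  refine key.trans (le_of_eq ?_)
  ring

end Taylor

/-! ### L² norms and the law of the sample -/

section LTwo

variable {X : Type*} [MeasurableSpace X] {μ : Measure X}

lemma eLpNorm_two_eq_sqrt {h : X → ℝ} (hh : MemLp h 2 μ) :
    eLpNorm h 2 μ = ENNReal.ofReal (√(∫ x, h x ^ 2 ∂μ)) := by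
  rw [hh.eLpNorm_eq_integral_rpow_norm (by simp) (by simp)]
  simp [Real.sqrt_eq_rpow]

lemma integrable_sq_of_eLpNorm_le {h : X → ℝ} {K : ℝ} (hh : AEStronglyMeasurable h μ)
    (hK : 0 ≤ K) (hb : eLpNorm h 2 μ ≤ ENNReal.ofReal K) :
    Integrable (fun x => h x ^ 2) μ ∧ √(∫ x, h x ^ 2 ∂μ) ≤ K := by
  have hm : MemLp h 2 μ := ⟨hh, hb.trans_lt ENNReal.ofReal_lt_top⟩
  refine ⟨hm.integrable_sq, ?_⟩
  rw [eLpNorm_two_eq_sqrt hm] at hb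
  exact (ENNReal.ofReal_le_ofReal_iff hK).1 hb

end LTwo

/-- Without separability the Borel sets of `Fin n → B` may exceed the product σ-algebra, so
continuity of a kernel alone does not make it measurable. Writing the sample as a sum of coordinate
embeddings reduces the claim to one coordinate, where `hP` supplies strong measurability. -/
lemma aestronglyMeasurable_sample {B : Type*} [NormedAddCommGroup B] [MeasurableSpace B]
    {P : Measure B} [IsProbabilityMeasure P] (hP : MemLp (fun w : B => w) 2 P) (n : ℕ) :
    AEStronglyMeasurable (fun x : Fin n → B => x) (Measure.pi fun _ : Fin n => P) := by
  classical
  have h : (fun x : Fin n → B => x) = fun x => ∑ i, Pi.single i (x i) := by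
    funext x
    exact (Finset.univ_sum_single x).symm
  rw [h]
  refine Finset.aestronglyMeasurable_fun_sum _ fun i _ => ?_
  have h1 : AEStronglyMeasurable (fun x : Fin n → B => x i) (Measure.pi fun _ : Fin n => P) :=
    hP.aestronglyMeasurable.comp_quasiMeasurePreserving (Measure.quasiMeasurePreserving_eval _ i)
  exact (continuous_single i).comp_aestronglyMeasurable h1

lemma measurePreserving_precomp {B : Type*} [MeasurableSpace B] {P : Measure B}
    [IsProbabilityMeasure P] {ι κ : Type*} [Fintype ι] [Fintype κ] {j : κ → ι} (hj : j.Injective) :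
    MeasurePreserving (fun x : ι → B => fun i => x (j i))
      (Measure.pi fun _ : ι => P) (Measure.pi fun _ : κ => P) := by
  refine ⟨by fun_prop, ?_⟩
  have h := (iIndepFun_pi (μ := fun _ : ι => P) (X := fun _ : ι => fun b : B => b)
    (fun _ => aemeasurable_id)).precomp hj
  rw [iIndepFun_iff_map_fun_eq_pi_map (fun i => (measurable_pi_apply _).aemeasurable)] at h
  rw [h]
  congr 1
  funext i
  exact (measurePreserving_eval (fun _ : ι => P) (j i)).map_eq

/-! ### Moments of U-statistics centered at the mean -/

section Moments

variable {B : Type*} [NormedAddCommGroup B] [NormedSpace ℝ B] [MeasurableSpace B]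
  {P : Measure B} [IsProbabilityMeasure P] {n k : ℕ}

lemma memLp_sub_mean (hP : MemLp (fun w : B => w) 2 P) :
    MemLp (fun w : B => w - mean P) 2 P := hP.sub (memLp_const _)

lemma integrable_norm_sub_mean_sq (hP : MemLp (fun w : B => w) 2 P) :
    Integrable (fun w : B => ‖w - mean P‖ ^ 2) P :=
  (memLp_two_iff_integrable_sq_norm (memLp_sub_mean hP).1).1 (memLp_sub_mean hP)

/-- Homogeneity extends the bound from the dual unit ball. The real supremum in `weakVar` can be
used only because `strongVar` bounds its range, by the finite second moment. -/
lemma integral_dual_sq_le (hP : MemLp (fun w : B => w) 2 P) (u : StrongDual ℝ B) :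
    ∫ w, u (w - mean P) ^ 2 ∂P ≤ weakVar P * ‖u‖ ^ 2 := by
  have hbdd : BddAbove (Set.range fun u : {u : StrongDual ℝ B // ‖u‖ ≤ 1} =>
      ∫ w, |u.1 (w - mean P)| ^ 2 ∂P) := by
    refine ⟨strongVar P, ?_⟩
    rintro _ ⟨u, rfl⟩
    refine integral_mono_of_nonneg (Filter.Eventually.of_forall fun w => by positivity)
      (integrable_norm_sub_mean_sq hP) (Filter.Eventually.of_forall fun w => ?_)
    have := u.1.le_of_opNorm_le u.2 (w - mean P)
    rw [one_mul, Real.norm_eq_abs] at this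
    dsimp only
    gcongr
  by_cases hu : ‖u‖ = 0
  · have : u = 0 := norm_eq_zero.1 hu
    simp [this]
  · have h := le_ciSup hbdd ⟨‖u‖⁻¹ • u, by rw [norm_smul]; simp [hu]⟩
    have e : ∫ w, |(‖u‖⁻¹ • u) (w - mean P)| ^ 2 ∂P =
        (‖u‖⁻¹) ^ 2 * ∫ w, u (w - mean P) ^ 2 ∂P := by
      rw [← integral_const_mul]
      congr 1
      funext w
      rw [smul_apply, smul_eq_mul, abs_mul, mul_pow, sq_abs, sq_abs]
    have h' : (‖u‖⁻¹) ^ 2 * ∫ w, u (w - mean P) ^ 2 ∂P ≤ weakVar P := e ▸ h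
    rw [inv_pow, inv_mul_le_iff₀ (by positivity)] at h'
    linarith

lemma aestronglyMeasurable_kernel (hP : MemLp (fun w : B => w) 2 P)
    (G : ContinuousMultilinearMap ℝ (fun _ : Fin k => B) ℝ)
    (j : Fin k → Fin n) :
    AEStronglyMeasurable (fun x : Fin n → B => G (fun i => x (j i) - mean P))
      (Measure.pi fun _ : Fin n => P) := by
  have hc : Continuous (fun x : Fin n → B => G (fun i => x (j i) - mean P)) :=
    G.cont.comp (by fun_prop)
  exact hc.comp_aestronglyMeasurable (aestronglyMeasurable_sample hP n)

lemma memLp_kernel_id (hP : MemLp (fun w : B => w) 2 P)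
    (G : ContinuousMultilinearMap ℝ (fun _ : Fin k => B) ℝ) :
    MemLp (fun x : Fin k → B => G (fun i => x i - mean P)) 2 (Measure.pi fun _ : Fin k => P) := by
  have hm : AEStronglyMeasurable (fun x : Fin k → B => G (fun i => x i - mean P))
      (Measure.pi fun _ : Fin k => P) := aestronglyMeasurable_kernel (n := k) hP G id
  rw [memLp_two_iff_integrable_sq hm]
  have hint : Integrable (fun x : Fin k → B => ‖G‖ ^ 2 * ∏ i, ‖x i - mean P‖ ^ 2)
      (Measure.pi fun _ : Fin k => P) :=
    (Integrable.fintype_prod (f := fun _ w => ‖w - mean P‖ ^ 2)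
      (fun _ => integrable_norm_sub_mean_sq hP)).const_mul _
  refine hint.mono' (hm.pow 2) (Filter.Eventually.of_forall fun x => ?_)
  rw [Real.norm_eq_abs, abs_pow, Finset.prod_pow, ← mul_pow]
  have := G.le_opNorm (fun i => x i - mean P)
  rw [Real.norm_eq_abs] at this
  gcongr

lemma memLp_kernel (hP : MemLp (fun w : B => w) 2 P)
    (G : ContinuousMultilinearMap ℝ (fun _ : Fin k => B) ℝ)
    (j : Fin k ↪o Fin n) :
    MemLp (fun x : Fin n → B => G (fun i => x (j i) - mean P)) 2
      (Measure.pi fun _ : Fin n => P) :=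
  (memLp_kernel_id hP G).comp_measurePreserving (measurePreserving_precomp j.injective)

/-- With all arguments but the first frozen, `G` is a linear functional of norm at most `‖G‖ ∏ ‖y i
- mean P‖`. Integrating the first argument therefore costs the weak variance only, and each
remaining one costs the strong variance. -/
lemma integral_kernel_id_sq_le (hP : MemLp (fun w : B => w) 2 P)
    (G : ContinuousMultilinearMap ℝ (fun _ : Fin (k + 1) => B) ℝ) :
    ∫ x : Fin (k + 1) → B, G (fun i => x i - mean P) ^ 2 ∂(Measure.pi fun _ => P) ≤
      ‖G‖ ^ 2 * (weakVar P * strongVar P ^ k) := by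
  have hmp := (measurePreserving_piFinSuccAbove (fun _ : Fin (k + 1) => P) 0).symm
  have hint := (memLp_kernel_id hP G).integrable_sq
  rw [← hmp.integral_comp', integral_prod_symm]
  swap
  · exact (hmp.integrable_comp_emb (MeasurableEquiv.measurableEmbedding _)).2 hint
  have hin : ∀ y : Fin k → B, ∫ a, G (fun i => (MeasurableEquiv.piFinSuccAbove
      (fun _ : Fin (k + 1) => B) 0).symm (a, y) i - mean P) ^ 2 ∂P ≤
      weakVar P * ‖G‖ ^ 2 * ∏ i, ‖y i - mean P‖ ^ 2 := by
    intro y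
    set u : StrongDual ℝ B := G.toContinuousLinearMap (Fin.cons 0 fun i => y i - mean P) 0 with hu
    have hua : ∀ a, u a = G (Fin.cons a fun i => y i - mean P) := by
      intro a
      rw [hu, ContinuousMultilinearMap.toContinuousLinearMap_apply, Fin.update_cons_zero]
    have hun : ‖u‖ ≤ ‖G‖ * ∏ i, ‖y i - mean P‖ := by
      refine u.opNorm_le_bound (by positivity) fun a => ?_
      rw [hua]
      refine (G.le_opNorm _).trans (le_of_eq ?_)
      rw [Fin.prod_univ_succ]
      simp only [Fin.cons_zero, Fin.cons_succ]
      ring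
    have hν : 0 ≤ weakVar P := Real.iSup_nonneg fun u => integral_nonneg fun w => by positivity
    have e : ∀ a, G (fun i => (MeasurableEquiv.piFinSuccAbove
        (fun _ : Fin (k + 1) => B) 0).symm (a, y) i - mean P) = u (a - mean P) := by
      intro a
      rw [hua]
      congr 1
      funext i
      refine Fin.cases ?_ (fun i => ?_) i <;> simp
    simp only [e]
    refine (integral_dual_sq_le hP u).trans ?_
    rw [Finset.prod_pow, mul_assoc, ← mul_pow]
    gcongr
  refine (integral_mono_of_nonneg
    (Filter.Eventually.of_forall fun y => integral_nonneg fun a => sq_nonneg _)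
    ((Integrable.fintype_prod (f := fun _ w => ‖w - mean P‖ ^ 2)
      (fun _ => integrable_norm_sub_mean_sq hP)).const_mul (weakVar P * ‖G‖ ^ 2))
    (Filter.Eventually.of_forall hin)).trans (le_of_eq ?_)
  rw [integral_const_mul, integral_fintype_prod_eq_pow (fun w => ‖w - mean P‖ ^ 2)]
  simp only [strongVar, Fintype.card_fin]
  ring

lemma integral_dual_eq_zero (hP : MemLp (fun w : B => w) 2 P) [CompleteSpace B]
    (u : StrongDual ℝ B) :
    ∫ w, u (w - mean P) ∂P = 0 := by
  have hint : Integrable (fun w : B => w) P := hP.integrable (by norm_num)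
  have hint' : Integrable (fun w : B => w - mean P) P := hint.sub (integrable_const _)
  rw [u.integral_comp_comm hint', integral_sub hint (integrable_const _)]
  simp [mean]

/-- Distinct terms of a U-statistic centered at the mean are orthogonal. -/
lemma integral_kernel_mul_eq_zero (hP : MemLp (fun w : B => w) 2 P) [CompleteSpace B]
    (G : ContinuousMultilinearMap ℝ (fun _ : Fin k => B) ℝ) {j j' : Fin k ↪o Fin n}
    (hjj : j ≠ j') :
    ∫ x : Fin n → B, G (fun i => x (j i) - mean P) * G (fun i => x (j' i) - mean P)
      ∂(Measure.pi fun _ => P) = 0 := by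
  -- Two different index sets of the same size: some index of `j` is missing from `j'`. Integrated
  -- over that coordinate first, one factor is linear and centered while the other is constant.
  obtain ⟨p, hp⟩ : ∃ p, j p ∉ Set.range j' := by
    by_contra! hcon
    refine hjj (orderEmb_ext_range (Set.eq_of_subset_of_ncard_le ?_ ?_ (Set.toFinite _)))
    · rintro _ ⟨p, rfl⟩; exact hcon p
    · rw [← Set.image_univ, ← Set.image_univ, Set.ncard_image_of_injective _ j.injective,
        Set.ncard_image_of_injective _ j'.injective]
  cases n with
  | zero => exact (j p).elim0
  | succ n =>
    have hmp := (measurePreserving_piFinSuccAbove (fun _ : Fin (n + 1) => P) (j p)).symm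
    have hint := (memLp_kernel hP G j).integrable_mul (memLp_kernel hP G j')
    rw [← hmp.integral_comp', integral_prod_symm]
    swap
    · exact (hmp.integrable_comp_emb (MeasurableEquiv.measurableEmbedding _)).2 hint
    refine integral_eq_zero_of_ae (Filter.Eventually.of_forall fun y => ?_)
    have hsymm : ∀ a, (MeasurableEquiv.piFinSuccAbove (fun _ : Fin (n + 1) => B) (j p)).symm
        (a, y) = Fin.insertNth (α := fun _ => B) (j p) a y := fun a => rfl
    set u : StrongDual ℝ B := G.toContinuousLinearMap
      (fun i => Fin.insertNth (α := fun _ => B) (j p) 0 y (j i) - mean P) p with hu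
    have e1 : ∀ a, G (fun i => Fin.insertNth (α := fun _ => B) (j p) a y (j i) - mean P) =
        u (a - mean P) := by
      intro a
      rw [hu, ContinuousMultilinearMap.toContinuousLinearMap_apply]
      congr 1
      funext i
      by_cases hi : i = p
      · subst hi; simp
      · obtain ⟨q, hq⟩ := Fin.exists_succAbove_eq (fun h => hi (j.injective h) : j i ≠ j p)
        rw [Function.update_of_ne hi, ← hq]
        simp
    have e2 : ∀ a, G (fun i => Fin.insertNth (α := fun _ => B) (j p) a y (j' i) - mean P) =
        G (fun i => Fin.insertNth (α := fun _ => B) (j p) 0 y (j' i) - mean P) := by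
      intro a
      congr 1
      funext i
      obtain ⟨q, hq⟩ := Fin.exists_succAbove_eq (fun h => hp ⟨i, h⟩ : j' i ≠ j p)
      rw [← hq]
      simp
    simp only [hsymm, e1]
    simp only [e2]
    rw [integral_mul_const, integral_dual_eq_zero hP]
    simp

/-- Second moment bound for U-statistics centered at the mean. -/
lemma integral_uStat_sq_le (hP : MemLp (fun w : B => w) 2 P) [CompleteSpace B]
    (G : ContinuousMultilinearMap ℝ (fun _ : Fin (k + 1) => B) ℝ) :
    ∫ x : Fin n → B, uStat G x (mean P) ^ 2 ∂(Measure.pi fun _ => P) ≤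
      ((n.choose (k + 1) : ℕ) : ℝ)⁻¹ * (‖G‖ ^ 2 * (weakVar P * strongVar P ^ k)) := by
  set c : ℝ := ((n.choose (k + 1) : ℕ) : ℝ) with hc
  have hexp : ∀ x : Fin n → B, uStat G x (mean P) ^ 2 =
      c⁻¹ ^ 2 * ∑ j : Fin (k + 1) ↪o Fin n, ∑ j' : Fin (k + 1) ↪o Fin n,
        G (fun i => x (j i) - mean P) * G (fun i => x (j' i) - mean P) := by
    intro x
    rw [uStat, mul_pow, pow_two (∑ j : Fin (k + 1) ↪o Fin n, _), Finset.sum_mul_sum]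
  simp only [hexp]
  have hint : ∀ j j' : Fin (k + 1) ↪o Fin n, Integrable (fun x : Fin n → B =>
      G (fun i => x (j i) - mean P) * G (fun i => x (j' i) - mean P)) (Measure.pi fun _ => P) :=
    fun j j' => (memLp_kernel hP G j).integrable_mul (memLp_kernel hP G j')
  rw [integral_const_mul, integral_finsetSum _
    (fun j _ => integrable_finsetSum _ fun j' _ => hint j j')]
  have hle : ∀ j : Fin (k + 1) ↪o Fin n, ∫ x : Fin n → B, ∑ j' : Fin (k + 1) ↪o Fin n,
      G (fun i => x (j i) - mean P) * G (fun i => x (j' i) - mean P) ∂(Measure.pi fun _ => P) ≤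
      ‖G‖ ^ 2 * (weakVar P * strongVar P ^ k) := by
    intro j
    rw [integral_finsetSum _ (fun j' _ => hint j j'), Finset.sum_eq_single j
      (fun j' _ hj' => integral_kernel_mul_eq_zero hP G hj'.symm) (by simp)]
    simp only [← pow_two]
    have hm : MeasurePreserving (fun x : Fin n → B => fun i => x (j i))
      (Measure.pi fun _ : Fin n => P) (Measure.pi fun _ : Fin (k + 1) => P) :=
      measurePreserving_precomp j.injective
    have := integral_kernel_id_sq_le hP G
    rw [← hm.map_eq, integral_map hm.measurable.aemeasurable
      (hm.map_eq.symm ▸ (memLp_kernel_id hP G).integrable_sq.aestronglyMeasurable)] at this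
    exact this
  calc _ ≤ c⁻¹ ^ 2 * ∑ j : Fin (k + 1) ↪o Fin n, ‖G‖ ^ 2 * (weakVar P * strongVar P ^ k) := by
        gcongr with j
        exact hle j
    _ = _ := by
        rw [Finset.sum_const, Finset.card_univ, card_orderEmb, nsmul_eq_mul, ← hc, ← mul_assoc]
        congr 1
        -- If `k + 1 > n` there are no index tuples and both sides vanish.
        by_cases h0 : c = 0
        · simp [h0]
        · field_simp

lemma memLp_uStat (hP : MemLp (fun w : B => w) 2 P)
    (G : ContinuousMultilinearMap ℝ (fun _ : Fin k => B) ℝ) :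
    MemLp (fun x : Fin n → B => uStat G x (mean P)) 2 (Measure.pi fun _ => P) :=
  (memLp_finsetSum _ fun j _ => memLp_kernel hP G j).const_mul _

lemma eLpNorm_uStat_le (hP : MemLp (fun w : B => w) 2 P) [CompleteSpace B]
    (G : ContinuousMultilinearMap ℝ (fun _ : Fin (k + 1) => B) ℝ) :
    eLpNorm (fun x : Fin n → B => uStat G x (mean P)) 2 (Measure.pi fun _ => P) ≤
      ENNReal.ofReal (‖G‖ * (√(weakVar P) * √(strongVar P) ^ k /
        √((n.choose (k + 1) : ℕ) : ℝ))) := by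
  rw [eLpNorm_two_eq_sqrt (memLp_uStat hP G)]
  have hν : 0 ≤ weakVar P := Real.iSup_nonneg fun u => integral_nonneg fun w => by positivity
  have hV : 0 ≤ strongVar P := integral_nonneg fun w => by positivity
  refine ENNReal.ofReal_le_ofReal ((Real.sqrt_le_sqrt (integral_uStat_sq_le hP G)).trans
    (le_of_eq ?_))
  rw [Real.sqrt_mul (by positivity), Real.sqrt_mul (by positivity), Real.sqrt_mul hν,
    Real.sqrt_sq (norm_nonneg _), Real.sqrt_inv]
  have hpow : √(strongVar P ^ k) = √(strongVar P) ^ k := by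
    rw [← Real.sqrt_sq (by positivity : 0 ≤ √(strongVar P) ^ k), ← pow_mul, mul_comm, pow_mul,
      Real.sq_sqrt hV]
  rw [hpow]
  ring

end Moments

/-! ### Factorials, binomial coefficients and the truncation level -/

section Numerics

lemma factorial_add_le {x : ℝ} (l m : ℕ) (h : ((l + m : ℕ) : ℝ) ≤ x) :
    ((l + m).factorial : ℝ) ≤ l.factorial * x ^ m := by
  induction m with
  | zero => simp
  | succ m ih =>
    have h1 : ((l + m : ℕ) : ℝ) ≤ x := by push_cast at h ⊢; linarith
    have h0 : 0 ≤ x := (Nat.cast_nonneg _).trans h1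
    have := ih h1
    rw [← add_assoc, Nat.factorial_succ, Nat.cast_mul, pow_succ]
    calc ((l + m + 1 : ℕ) : ℝ) * ((l + m).factorial : ℝ)
        ≤ x * (l.factorial * x ^ m) := by gcongr; exact h
      _ = _ := by ring

lemma rpow_pow_comm' {x : ℝ} (hx : 0 ≤ x) (β : ℝ) (m : ℕ) : (x ^ m) ^ β = (x ^ β) ^ m := by
  rw [← Real.rpow_natCast, ← Real.rpow_natCast, ← Real.rpow_mul hx, ← Real.rpow_mul hx, mul_comm]

lemma factorial_add_rpow_le {x β : ℝ} (hβ : 0 ≤ β) (l m : ℕ) (h : ((l + m : ℕ) : ℝ) ≤ x) :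
    ((l + m).factorial : ℝ) ^ β ≤ (l.factorial : ℝ) ^ β * (x ^ β) ^ m := by
  have h0 : 0 ≤ x := (Nat.cast_nonneg _).trans h
  rw [← rpow_pow_comm' h0, ← Real.mul_rpow (by positivity) (by positivity)]
  exact Real.rpow_le_rpow (by positivity) (factorial_add_le l m h) hβ

/-- Only `s`, not `s + 1`, is known to be below `x`; the last factor is bounded by `2x`, which is
one source of the power of two in the theorem. -/
lemma factorial_succ_rpow_le {x β : ℝ} (hβ : 0 ≤ β) {s : ℕ} (hs : 1 ≤ s) (h : (s : ℝ) ≤ x) :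
    ((s + 1).factorial : ℝ) ^ β ≤ 2 ^ β * (x ^ β) ^ s := by
  obtain ⟨k, rfl⟩ := Nat.exists_eq_add_of_le hs
  have hx : 1 ≤ x := by push_cast at h; linarith [(Nat.cast_nonneg k : (0 : ℝ) ≤ k)]
  have h0 : 0 ≤ x := by linarith
  rw [← rpow_pow_comm' h0, ← Real.mul_rpow (by positivity) (by positivity)]
  refine Real.rpow_le_rpow (by positivity) ?_ hβ
  have h1 := factorial_add_le 1 k h
  rw [Nat.factorial_succ, Nat.cast_mul]
  calc ((1 + k + 1 : ℕ) : ℝ) * ((1 + k).factorial : ℝ)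
      ≤ (2 * x) * (Nat.factorial 1 * x ^ k) := by
        gcongr
        push_cast at h ⊢
        linarith
    _ = 2 * x ^ (1 + k) := by simp; ring

/-- Induction through `C(n+1, l+1) = (n+1)/(l+1) · C(n, l)`, with `(n+1)/(l+1) ≤ n/l` because `l ≤
n`. -/
lemma div_pow_le_choose {n l : ℕ} (hl : l ≤ n) : ((n : ℝ) / l) ^ l ≤ (n.choose l : ℝ) := by
  induction l generalizing n with
  | zero => simp
  | succ l ih =>
    obtain ⟨n, rfl⟩ : ∃ m, n = m + 1 := ⟨n - 1, by omega⟩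
    have hl' : l ≤ n := by omega
    have hlr : (l : ℝ) ≤ n := by exact_mod_cast hl'
    have e : ((n + 1).choose (l + 1) : ℝ) = ((n + 1 : ℕ) : ℝ) / ((l + 1 : ℕ) : ℝ) * n.choose l := by
      have := Nat.add_one_mul_choose_eq n l
      have h2 : ((n + 1 : ℕ) : ℝ) * n.choose l = (n + 1).choose (l + 1) * ((l + 1 : ℕ) : ℝ) := by
        exact_mod_cast this
      field_simp
      linarith
    rw [e, pow_succ']
    gcongr
    refine le_trans ?_ (ih hl')
    rcases Nat.eq_zero_or_pos l with rfl | hpos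
    · simp
    · have : (0 : ℝ) < l := by exact_mod_cast hpos
      gcongr ?_ ^ l
      rw [div_le_div_iff₀ (by positivity) this]
      push_cast
      nlinarith

lemma inv_sqrt_choose_le {n l : ℕ} (hn : 1 ≤ n) (hl : l ≤ n) :
    1 / √(n.choose l : ℝ) ≤ (√l / √n) ^ l := by
  rcases Nat.eq_zero_or_pos l with rfl | hpos
  · simp
  have h1 : (0 : ℝ) < n := by exact_mod_cast hn
  have h2 : (0 : ℝ) < l := by exact_mod_cast hpos
  have h3 : (√n / √l) ^ l ≤ √(n.choose l : ℝ) := by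
    refine Real.le_sqrt_of_sq_le ?_
    rw [← pow_mul, mul_comm, pow_mul, div_pow, Real.sq_sqrt h1.le, Real.sq_sqrt h2.le]
    exact div_pow_le_choose hl
  have h4 : (√l / √n) ^ l = 1 / (√n / √l) ^ l := by
    rw [one_div, ← inv_pow, inv_div]
  rw [h4]
  exact one_div_le_one_div_of_le (by positivity) h3

/-- The negative binomial series, with `2/5` a rational upper bound for `1/e`. The growth `5/3` per
order is harmless since it later meets a decay `2/5`, and `5/3 · 2/5 = 2/3 < 1`. -/
lemma sum_choose_mul_pow_le {q : ℝ} (hq : 0 ≤ q) (hq' : q ≤ 2 / 5) (l N : ℕ) :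
    ∑ m ∈ Finset.range N, ((m + l).choose l : ℝ) * q ^ m ≤ (5 / 3) ^ (l + 1) := by
  have hs := hasSum_choose_mul_geometric_of_norm_lt_one (𝕜 := ℝ) l (r := 2 / 5)
    (by rw [Real.norm_eq_abs, abs_of_nonneg] <;> norm_num)
  calc ∑ m ∈ Finset.range N, ((m + l).choose l : ℝ) * q ^ m
      ≤ ∑ m ∈ Finset.range N, ((m + l).choose l : ℝ) * (2 / 5) ^ m := by
        gcongr
    _ ≤ 1 / (1 - 2 / 5) ^ (l + 1) := sum_le_hasSum _ (fun m _ => by positivity) hs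
    _ = (5 / 3) ^ (l + 1) := by rw [one_div, ← inv_pow]; norm_num

lemma sum_two_thirds_le (N : ℕ) : ∑ k ∈ Finset.range N, (2 / 3 : ℝ) ^ k ≤ 3 := by
  have h := sum_le_hasSum (Finset.range N) (fun k _ => by positivity)
    (hasSum_geometric_of_lt_one (r := (2 / 3 : ℝ)) (by norm_num) (by norm_num))
  norm_num at h
  exact h

lemma exp_neg_one_le : (Real.exp 1)⁻¹ ≤ 2 / 5 := by
  rw [inv_le_comm₀ (Real.exp_pos 1) (by norm_num)]
  linarith [Real.exp_one_gt_d9]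

variable {n : ℕ}

lemma log_exp_mul (hn : 1 ≤ n) : Real.log (Real.exp 1 * n) = 1 + Real.log n := by
  rw [Real.log_mul (Real.exp_pos 1).ne' (by positivity), Real.log_exp]

lemma one_le_log (hn : 1 ≤ n) : 1 ≤ Real.log (Real.exp 1 * n) := by
  rw [log_exp_mul hn]
  linarith [Real.log_nonneg (show (1 : ℝ) ≤ n by exact_mod_cast hn)]

lemma truncLevel_le_log (hn : 1 ≤ n) : (truncLevel n : ℝ) ≤ Real.log (Real.exp 1 * n) :=
  Nat.floor_le (by linarith [one_le_log hn])

lemma one_le_truncLevel (hn : 1 ≤ n) : 1 ≤ truncLevel n :=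
  Nat.le_floor (by exact_mod_cast one_le_log hn)

lemma truncLevel_le (hn : 1 ≤ n) : truncLevel n ≤ n := by
  have h := truncLevel_le_log hn
  rw [log_exp_mul hn] at h
  have := Real.log_le_sub_one_of_pos (show (0 : ℝ) < n by exact_mod_cast hn)
  exact_mod_cast (show (truncLevel n : ℝ) ≤ n by linarith)

/-- The factor `e` inside the logarithm offsets the floor: `⌊1 + log n⌋ ≥ log n`. -/
lemma exp_inv_pow_truncLevel_le (hn : 1 ≤ n) : (Real.exp 1)⁻¹ ^ truncLevel n ≤ 1 / n := by
  have h0 : (0 : ℝ) < n := by exact_mod_cast hn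
  have h : Real.log n ≤ truncLevel n := by
    have := Nat.lt_floor_add_one (Real.log (Real.exp 1 * n))
    rw [log_exp_mul hn] at this
    rw [truncLevel, log_exp_mul hn]
    linarith
  rw [inv_pow, ← Real.exp_nat_mul, mul_one, one_div]
  gcongr
  exact (Real.log_le_iff_le_exp h0).1 h

/-- Trades the logarithm for a power: it turns `(s + 1)/n` into the rate `n^(-3/4)` of the second
bound, through `log n ≤ 4 n^(1/4)`. -/
lemma truncLevel_succ_le (hn : 1 ≤ n) : (truncLevel n : ℝ) + 1 ≤ 6 * (n : ℝ) ^ (1 / 4 : ℝ) := by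
  have h0 : (0 : ℝ) < n := by exact_mod_cast hn
  have h := truncLevel_le_log hn
  rw [log_exp_mul hn] at h
  have h1 : Real.log n ≤ 4 * (n : ℝ) ^ (1 / 4 : ℝ) := by
    have := Real.log_le_rpow_div h0.le (show (0 : ℝ) < 1 / 4 by norm_num)
    linarith
  have h2 : (1 : ℝ) ≤ (n : ℝ) ^ (1 / 4 : ℝ) :=
    Real.one_le_rpow (by exact_mod_cast hn) (by norm_num)
  linarith

/-- Control of the Taylor remainder at the truncation level. -/
lemma pow_mul_factorial_rpow_le {α R r : ℝ} (hn : 1 ≤ n) (hα : 1 ≤ α) (hR : 0 < R) (hr : 0 ≤ r)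
    (h : R * r * Real.log (Real.exp 1 * n) ^ (α - 1) ≤ (Real.exp 1)⁻¹) :
    (R * r) ^ truncLevel n * ((truncLevel n + 1).factorial : ℝ) ^ (α - 1) ≤
      2 ^ (α - 1) / n := by
  have hL := one_le_log hn
  set L := Real.log (Real.exp 1 * n)
  have hL0 : 0 ≤ L := by linarith
  calc (R * r) ^ truncLevel n * ((truncLevel n + 1).factorial : ℝ) ^ (α - 1)
      ≤ (R * r) ^ truncLevel n * (2 ^ (α - 1) * (L ^ (α - 1)) ^ truncLevel n) := by
        gcongr
        exact factorial_succ_rpow_le (by linarith) (one_le_truncLevel hn) (truncLevel_le_log hn)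
    _ = 2 ^ (α - 1) * (R * r * L ^ (α - 1)) ^ truncLevel n := by rw [mul_pow (R * r)]; ring
    _ ≤ 2 ^ (α - 1) * (Real.exp 1)⁻¹ ^ truncLevel n := by gcongr
    _ ≤ 2 ^ (α - 1) * (1 / n) := by gcongr; exact exp_inv_pow_truncLevel_le hn
    _ = _ := by ring

/-- The order `k + 1` term, relative to the linear rate. -/
lemma term_le_linear_rate {α R V L : ℝ} {k : ℕ} (hn : 1 ≤ n) (hk : ((k + 1 : ℕ) : ℝ) ≤ L)
    (hkn : k + 1 ≤ n) (hα : 1 ≤ α) (hR : 0 < R)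
    (h : R * L ^ α * √(V / n) ≤ 2 / 5) :
    R ^ (k + 1) * ((k + 1).factorial : ℝ) ^ (α - 1) * (√V ^ k / √(n.choose (k + 1) : ℝ)) ≤
      R / √n * (2 / 5) ^ k := by
  have hL1 : 1 ≤ L := by push_cast at hk; linarith [(Nat.cast_nonneg k : (0 : ℝ) ≤ k)]
  have hL0 : 0 < L := by linarith
  set A := L ^ (α - 1) with hA
  have hA0 : 0 ≤ A := by positivity
  have hnn : (0 : ℝ) < √n := Real.sqrt_pos.2 (by exact_mod_cast hn)
  have hLα : L ^ α = L * A := by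
    rw [hA, ← Real.rpow_one_add' hL0.le (by linarith)]; congr 1; ring
  set y : ℝ := √((k + 1 : ℕ) : ℝ) with hy
  have hy1 : 1 ≤ y := by
    rw [hy, Real.one_le_sqrt]
    push_cast
    linarith [(Nat.cast_nonneg k : (0 : ℝ) ≤ k)]
  have hyy : y * y ≤ L := by rw [hy, Real.mul_self_sqrt (by positivity)]; exact hk
  have hf : ((k + 1).factorial : ℝ) ^ (α - 1) ≤ A ^ k := by
    have := factorial_add_rpow_le (β := α - 1) (by linarith) 1 k (x := L)
      (by rw [add_comm]; exact hk)
    rw [add_comm k 1]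
    simpa using this
  -- The hypothesis controls the product with `L ≥ y²`, whereas one `y` is needed. The spare `y⁻¹`
  -- in each of the `k` factors absorbs the single `y` left over from `(y/√n)^(k+1)`; for `k = 0`
  -- one has `y = 1`.
  have hz : R * A * (√V / √n) * y ≤ 2 / 5 * y⁻¹ := by
    rw [Real.sqrt_div' V (Nat.cast_nonneg n), hLα] at h
    have h1 : R * A * (√V / √n) * (y * y) ≤ 2 / 5 := by
      calc R * A * (√V / √n) * (y * y) ≤ R * A * (√V / √n) * L := by gcongr
        _ = R * (L * A) * (√V / √n) := by ring
        _ ≤ 2 / 5 := h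
    rw [← div_eq_mul_inv, le_div_iff₀ (by linarith)]
    linarith
  calc R ^ (k + 1) * ((k + 1).factorial : ℝ) ^ (α - 1) * (√V ^ k / √(n.choose (k + 1) : ℝ))
      = R ^ (k + 1) * ((k + 1).factorial : ℝ) ^ (α - 1) *
        (√V ^ k * (1 / √(n.choose (k + 1) : ℝ))) := by ring
    _ ≤ R ^ (k + 1) * A ^ k * (√V ^ k * (y / √n) ^ (k + 1)) := by
        gcongr
        exact inv_sqrt_choose_le hn hkn
    _ = R / √n * (y * (R * A * (√V / √n) * y) ^ k) := by
        rw [div_pow, mul_pow, mul_pow, mul_pow, div_pow, pow_succ, pow_succ, pow_succ]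
        field_simp
    _ ≤ R / √n * (y * (2 / 5 * y⁻¹) ^ k) := by gcongr
    _ = R / √n * (2 / 5) ^ k * (y * y⁻¹ ^ k) := by rw [mul_pow]; ring
    _ ≤ R / √n * (2 / 5) ^ k * 1 := by
        gcongr
        rcases Nat.eq_zero_or_pos k with rfl | hk0
        · simp [hy]
        · obtain ⟨i, rfl⟩ : ∃ i, k = i + 1 := ⟨k - 1, by omega⟩
          rw [pow_succ', ← mul_assoc, mul_inv_cancel₀ (by linarith), one_mul]
          exact pow_le_one₀ (by positivity) (inv_le_one_of_one_le₀ hy1)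
    _ = _ := by ring

/-- The order `k + 2` term, relative to the quadratic rate. -/
lemma term_le_quadratic_rate {α R V L : ℝ} {k : ℕ} (hn : 1 ≤ n) (hk : ((k + 2 : ℕ) : ℝ) ≤ L)
    (hkn : k + 2 ≤ n) (hα : 1 ≤ α) (hR : 0 < R)
    (h : R * L ^ α * √(V / n) ≤ 2 / 5) :
    R ^ (k + 2) * ((k + 2).factorial : ℝ) ^ (α - 1) *
      (√V ^ (k + 1) / √(n.choose (k + 2) : ℝ)) ≤
      2 ^ (α - 1) * (2 * R ^ 2 * (√V / n) * (2 / 5) ^ k) := by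
  have hL1 : 1 ≤ L := by push_cast at hk; linarith [(Nat.cast_nonneg k : (0 : ℝ) ≤ k)]
  have hL0 : 0 < L := by linarith
  set A := L ^ (α - 1) with hA
  have hA0 : 0 ≤ A := by positivity
  have hnn : (0 : ℝ) < √n := Real.sqrt_pos.2 (by exact_mod_cast hn)
  have hLα : L ^ α = L * A := by
    rw [hA, ← Real.rpow_one_add' hL0.le (by linarith)]; congr 1; ring
  set y : ℝ := √((k + 2 : ℕ) : ℝ) with hy
  have hy1 : 1 ≤ y := by
    rw [hy, Real.one_le_sqrt]
    push_cast
    linarith [(Nat.cast_nonneg k : (0 : ℝ) ≤ k)]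
  have hy2 : y * y = ((k + 2 : ℕ) : ℝ) := Real.mul_self_sqrt (by positivity)
  have hyy : y * y ≤ L := hy2 ▸ hk
  -- Keeping `2!` apart leaves exactly `k` factors to bound by `L`, to match the exponent of the
  -- geometric factor.
  have hf : ((k + 2).factorial : ℝ) ^ (α - 1) ≤ 2 ^ (α - 1) * A ^ k := by
    have := factorial_add_rpow_le (β := α - 1) (by linarith) 2 k (x := L)
      (by rw [add_comm]; exact hk)
    rw [add_comm k 2]
    simpa using this
  have hz : R * A * (√V / √n) * y ≤ 2 / 5 * y⁻¹ := by
    rw [Real.sqrt_div' V (Nat.cast_nonneg n), hLα] at h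
    have h1 : R * A * (√V / √n) * (y * y) ≤ 2 / 5 := by
      calc R * A * (√V / √n) * (y * y) ≤ R * A * (√V / √n) * L := by gcongr
        _ = R * (L * A) * (√V / √n) := by ring
        _ ≤ 2 / 5 := h
    rw [← div_eq_mul_inv, le_div_iff₀ (by linarith)]
    linarith
  -- The left side is `2` for `k = 0`, `√3` for `k = 1`, and at most `1` afterwards.
  have hyk : y * y * y⁻¹ ^ k ≤ 2 := by
    have hinv : y⁻¹ ≤ 1 := inv_le_one_of_one_le₀ hy1
    match k, hy2 with
    | 0, hy2 => simp [hy2]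
    | 1, hy2 =>
      rw [pow_one, mul_assoc, mul_inv_cancel₀ (by linarith), mul_one]
      push_cast at hy2
      nlinarith
    | i + 2, hy2 =>
      have e : y * y * y⁻¹ ^ (i + 2) = y⁻¹ ^ i := by
        rw [pow_add, pow_two]
        field_simp
      rw [e]
      exact (pow_le_one₀ (by positivity) hinv).trans (by norm_num)
  have hnsq : √(n : ℝ) * √n = n := Real.mul_self_sqrt (Nat.cast_nonneg n)
  calc R ^ (k + 2) * ((k + 2).factorial : ℝ) ^ (α - 1) *
        (√V ^ (k + 1) / √(n.choose (k + 2) : ℝ))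
      = R ^ (k + 2) * ((k + 2).factorial : ℝ) ^ (α - 1) *
        (√V ^ (k + 1) * (1 / √(n.choose (k + 2) : ℝ))) := by ring
    _ ≤ R ^ (k + 2) * (2 ^ (α - 1) * A ^ k) * (√V ^ (k + 1) * (y / √n) ^ (k + 2)) := by
        gcongr
        exact inv_sqrt_choose_le hn hkn
    _ = 2 ^ (α - 1) * (R ^ 2 * (√V / (√n * √n)) * (y * y * (R * A * (√V / √n) * y) ^ k)) := by
        rw [div_pow, mul_pow, mul_pow, mul_pow, div_pow, pow_add, pow_add, pow_add, pow_add,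
          pow_one, pow_two y, pow_two (√(n : ℝ))]
        field_simp
    _ ≤ 2 ^ (α - 1) * (R ^ 2 * (√V / n) * (y * y * (2 / 5 * y⁻¹) ^ k)) := by
        rw [hnsq]
        gcongr
    _ = 2 ^ (α - 1) * (R ^ 2 * (√V / n) * (2 / 5) ^ k * (y * y * y⁻¹ ^ k)) := by
        rw [mul_pow]; ring
    _ ≤ 2 ^ (α - 1) * (R ^ 2 * (√V / n) * (2 / 5) ^ k * 2) := by gcongr
    _ = _ := by ring

end Numerics

/-! ### Risk for a fixed pilot value -/

section Conditional

variable {B : Type*} [NormedAddCommGroup B] [NormedSpace ℝ B]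

lemma factorial_rpow_eq {α : ℝ} (k : ℕ) :
    (k.factorial : ℝ) ^ α = k.factorial * (k.factorial : ℝ) ^ (α - 1) := by
  have h : (0 : ℝ) < k.factorial := by exact_mod_cast k.factorial_pos
  rw [Real.rpow_sub_one h.ne']
  field_simp

/-- Since `((m+l)!)^α/(m! l!) = C(m+l, l) ((m+l)!)^(α-1)` and `m + l ≤ s ≤ L`, the sum over `m` is
dominated by a negative binomial series at `R r L^(α-1)`. -/
lemma norm_taylorForm_div_le {f : B → ℝ} {s l : ℕ} {t θ : B} {α R r F L : ℝ}
    (hα : 1 ≤ α) (hR : 0 < R) (hF : 0 ≤ F)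
    (hb : ∀ k, ‖iteratedFDeriv ℝ k f t‖ ≤ F * (R ^ k * (k.factorial : ℝ) ^ α))
    (ht : ‖θ - t‖ ≤ r) (hs : (s : ℝ) ≤ L) (h : R * r * L ^ (α - 1) ≤ 2 / 5) :
    ‖taylorForm f s t θ l‖ / l.factorial ≤
      F * (R ^ l * (l.factorial : ℝ) ^ (α - 1)) * (5 / 3) ^ (l + 1) := by
  have hr : 0 ≤ r := (norm_nonneg _).trans ht
  have hL : 0 ≤ L := (Nat.cast_nonneg s).trans hs
  have hl0 : (0 : ℝ) < l.factorial := by exact_mod_cast l.factorial_pos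
  rw [div_le_iff₀ hl0]
  calc ‖taylorForm f s t θ l‖
      ≤ ∑ m ∈ Finset.range (s + 1 - l), ‖((m.factorial : ℝ)⁻¹) •
          fixFirst (θ - t) (iteratedFDeriv ℝ (m + l) f t)‖ := norm_sum_le _ _
    _ ≤ ∑ m ∈ Finset.range (s + 1 - l), F * (R ^ l * (l.factorial : ℝ) ^ (α - 1)) *
          l.factorial * (((m + l).choose l : ℝ) * (R * r * L ^ (α - 1)) ^ m) := by
        refine Finset.sum_le_sum fun m hm => ?_
        have hm' : m + l ≤ s := by have := Finset.mem_range.1 hm; omega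
        have hm0 : (0 : ℝ) < m.factorial := by exact_mod_cast m.factorial_pos
        have hc : ((m + l).factorial : ℝ) =
            ((m + l).choose l : ℝ) * l.factorial * m.factorial := by
          have := Nat.choose_mul_factorial_mul_factorial (n := m + l) (k := l) (by omega)
          rw [show m + l - l = m by omega] at this
          exact_mod_cast this.symm
        have hfac : ((m + l).factorial : ℝ) ^ (α - 1) ≤
            (l.factorial : ℝ) ^ (α - 1) * (L ^ (α - 1)) ^ m := by
          rw [add_comm m l]
          refine factorial_add_rpow_le (by linarith) l m (le_trans ?_ hs)
          exact_mod_cast (by omega : l + m ≤ s)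
        rw [norm_smul, norm_inv, Real.norm_eq_abs, Nat.abs_cast]
        calc (m.factorial : ℝ)⁻¹ * ‖fixFirst (θ - t) (iteratedFDeriv ℝ (m + l) f t)‖
            ≤ (m.factorial : ℝ)⁻¹ *
              (F * (R ^ (m + l) * ((m + l).factorial : ℝ) ^ α) * r ^ m) := by
              gcongr
              refine (norm_fixFirst_le _ _).trans ?_
              gcongr
              exact hb _
          _ ≤ (m.factorial : ℝ)⁻¹ * (F * (R ^ (m + l) *
              ((((m + l).choose l : ℝ) * l.factorial * m.factorial) *
                ((l.factorial : ℝ) ^ (α - 1) * (L ^ (α - 1)) ^ m))) * r ^ m) := by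
              rw [factorial_rpow_eq, ← hc]
              gcongr
          _ = _ := by
              rw [mul_pow, mul_pow, pow_add]
              field_simp
    _ = F * (R ^ l * (l.factorial : ℝ) ^ (α - 1)) * l.factorial *
          ∑ m ∈ Finset.range (s + 1 - l), ((m + l).choose l : ℝ) * (R * r * L ^ (α - 1)) ^ m := by
        rw [Finset.mul_sum]
    _ ≤ F * (R ^ l * (l.factorial : ℝ) ^ (α - 1)) * l.factorial * (5 / 3) ^ (l + 1) := by
        gcongr
        exact sum_choose_mul_pow_le (by positivity) h l _
    _ = _ := by ring

variable {n : ℕ} {f : B → ℝ} {t : B} {α R r F : ℝ}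

/-- The remainders of the Taylor expansions of `f` and of its derivative. -/
lemma abs_bias_le (hn : 1 ≤ n) (hα : 1 ≤ α) (hR : 0 < R) (hF : 0 ≤ F) {θ : B}
    (hsm : ∀ x ∈ Metric.closedBall θ r, ContDiffAt ℝ ((⊤ : ℕ∞) : WithTop ℕ∞) f x)
    (hb : ∀ x ∈ Metric.closedBall θ r, ∀ k,
      ‖iteratedFDeriv ℝ k f x‖ ≤ F * (R ^ k * (k.factorial : ℝ) ^ α))
    (h : R * r * Real.log (Real.exp 1 * n) ^ (α - 1) ≤ (Real.exp 1)⁻¹)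
    (ht : t ∈ Metric.closedBall θ r) :
    |taylorForm f (truncLevel n) t θ 0 0 - f θ| ≤ F * (2 ^ (α - 1) * (R * r / n)) ∧
    ‖taylorForm f (truncLevel n) t θ 1 - iteratedFDeriv ℝ 1 f θ‖ ≤
      F * (2 ^ (α - 1) * (R * ((truncLevel n + 1 : ℝ) / n))) := by
  have htr : ‖θ - t‖ ≤ r := by rw [← dist_eq_norm, dist_comm]; exact ht
  have hr : 0 ≤ r := (norm_nonneg _).trans htr
  have hseg : segment ℝ t θ ⊆ Metric.closedBall θ r :=
    (convex_closedBall θ r).segment_subset ht (Metric.mem_closedBall_self hr)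
  set s := truncLevel n with hs
  have hs1 : 1 ≤ s := one_le_truncLevel hn
  have hK : 0 ≤ F * (R ^ (s + 1) * ((s + 1).factorial : ℝ) ^ α) := by positivity
  have key := fun (l : ℕ) (hl : l ≤ s) =>
    norm_iteratedFDeriv_sub_taylorForm_le hl hK (fun x hx => hsm x (hseg hx))
      (fun x hx => hb x (hseg hx) (s + 1))
  have hnum := pow_mul_factorial_rpow_le hn hα hR hr h
  rw [← hs] at hnum
  have hf1 : (0 : ℝ) < (s + 1).factorial := by exact_mod_cast (s + 1).factorial_pos
  have hf0 : (0 : ℝ) < s.factorial := by exact_mod_cast s.factorial_pos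
  constructor
  · have h0 := (ContinuousMultilinearMap.le_opNorm
      (iteratedFDeriv ℝ 0 f θ - taylorForm f s t θ 0) 0).trans
      (mul_le_mul_of_nonneg_right (key 0 (Nat.zero_le s)) (by positivity))
    rw [sub_apply, iteratedFDeriv_zero_apply, Real.norm_eq_abs, abs_sub_comm] at h0
    refine h0.trans ?_
    simp only [Finset.univ_eq_empty, Finset.prod_empty, mul_one, Nat.sub_zero]
    calc F * (R ^ (s + 1) * ((s + 1).factorial : ℝ) ^ α) * ‖θ - t‖ ^ (s + 1) /
          ((s + 1).factorial : ℝ)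
        ≤ F * (R ^ (s + 1) * ((s + 1).factorial : ℝ) ^ α) * r ^ (s + 1) /
          ((s + 1).factorial : ℝ) := by gcongr
      _ = F * (R * r) * ((R * r) ^ s * ((s + 1).factorial : ℝ) ^ (α - 1)) := by
          rw [factorial_rpow_eq, mul_pow, pow_succ, pow_succ]
          field_simp
      _ ≤ F * (R * r) * (2 ^ (α - 1) / n) := by gcongr
      _ = _ := by ring
  · rw [norm_sub_rev]
    refine (key 1 hs1).trans ?_
    simp only [Nat.add_sub_cancel]
    calc F * (R ^ (s + 1) * ((s + 1).factorial : ℝ) ^ α) * ‖θ - t‖ ^ s / (s.factorial : ℝ)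
        ≤ F * (R ^ (s + 1) * ((s + 1).factorial : ℝ) ^ α) * r ^ s / (s.factorial : ℝ) := by
          gcongr
      -- The expansion of the first derivative is one order shorter: it divides by `s!` instead of
      -- `(s+1)!`, which costs the factor `s + 1`.
      _ = F * (R * (s + 1)) * ((R * r) ^ s * ((s + 1).factorial : ℝ) ^ (α - 1)) := by
          rw [factorial_rpow_eq, mul_pow, pow_succ, Nat.factorial_succ]
          push_cast
          field_simp
      _ ≤ F * (R * (s + 1)) * (2 ^ (α - 1) / n) := by gcongr
      _ = _ := by ring

variable [MeasurableSpace B] {P : Measure B} [IsProbabilityMeasure P]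

/-- Minkowski across the different orders; no orthogonality between orders is needed, because their
norms will decay geometrically. -/
lemma eLpNorm_const_add_sum_uStat_le [CompleteSpace B] (hP : MemLp (fun w : B => w) 2 P)
    (b : ℝ) (N : ℕ) (T : ∀ k : ℕ, ContinuousMultilinearMap ℝ (fun _ : Fin (k + 1) => B) ℝ)
    {a : ℕ → ℝ} (ha : ∀ k < N, ‖T k‖ * (√(weakVar P) * √(strongVar P) ^ k /
        √((n.choose (k + 1) : ℕ) : ℝ)) ≤ a k) :
    eLpNorm (fun x : Fin n → B => b + ∑ k ∈ Finset.range N, uStat (T k) x (mean P)) 2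
      (Measure.pi fun _ => P) ≤ ENNReal.ofReal (|b| + ∑ k ∈ Finset.range N, a k) := by
  have ha0 : ∀ k ∈ Finset.range N, 0 ≤ a k := fun k hk =>
    le_trans (by positivity) (ha k (Finset.mem_range.1 hk))
  have hm : ∀ k, AEStronglyMeasurable (fun x : Fin n → B => uStat (T k) x (mean P))
      (Measure.pi fun _ => P) := fun k => (memLp_uStat hP (T k)).1
  refine (eLpNorm_add_le (f := fun _ => b)
    (g := fun x : Fin n → B => ∑ k ∈ Finset.range N, uStat (T k) x (mean P))
    aestronglyMeasurable_const (Finset.aestronglyMeasurable_fun_sum _ fun k _ => hm k)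
    (by norm_num)).trans ?_
  rw [ENNReal.ofReal_add (abs_nonneg b) (Finset.sum_nonneg ha0), ENNReal.ofReal_sum_of_nonneg ha0]
  gcongr
  · rw [eLpNorm_const _ (by simp) (IsProbabilityMeasure.ne_zero _)]
    simp [Real.enorm_eq_ofReal_abs]
  · have := eLpNorm_sum_le (s := Finset.range N) (p := 2)
      (f := fun k => fun x : Fin n → B => uStat (T k) x (mean P)) (fun k _ => hm k) (by norm_num)
    rw [Finset.sum_fn] at this
    refine this.trans (Finset.sum_le_sum fun k hk => ?_)
    exact (eLpNorm_uStat_le hP (T k)).trans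
      (ENNReal.ofReal_le_ofReal (ha k (Finset.mem_range.1 hk)))

/-- Conditional risk of the one-sided estimator, given the pilot. -/
lemma eLpNorm_oneSided_sub_le [CompleteSpace B] (hP : MemLp (fun w : B => w) 2 P)
    (hn : 1 ≤ n) (hα : 1 ≤ α) (hR : 0 < R) (hF : 0 ≤ F)
    (hsm : ∀ x ∈ Metric.closedBall (mean P) r, ContDiffAt ℝ ((⊤ : ℕ∞) : WithTop ℕ∞) f x)
    (hb : ∀ x ∈ Metric.closedBall (mean P) r, ∀ k,
      ‖iteratedFDeriv ℝ k f x‖ ≤ F * (R ^ k * (k.factorial : ℝ) ^ α))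
    (h : R * r * Real.log (Real.exp 1 * n) ^ (α - 1) ≤ (Real.exp 1)⁻¹)
    (h' : R * Real.log (Real.exp 1 * n) ^ α * √(strongVar P / n) ≤ (Real.exp 1)⁻¹)
    (ht : t ∈ Metric.closedBall (mean P) r) :
    eLpNorm (fun x : Fin n → B => oneSided f (truncLevel n) x t - f (mean P)) 2
      (Measure.pi fun _ => P) ≤
      ENNReal.ofReal (F * (2 ^ (α - 1) * (R * r / n)) +
        F * (25 / 3 * R * (√(weakVar P) / √n))) := by
  set θ := mean P with hθ
  set s := truncLevel n with hs
  have hsL := truncLevel_le_log hn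
  rw [← hs] at hsL
  have htr : ‖θ - t‖ ≤ r := by rw [← dist_eq_norm, dist_comm]; exact ht
  have hsn : s ≤ n := truncLevel_le hn
  have hfun : (fun x : Fin n → B => oneSided f s x t - f θ) = fun x =>
      (taylorForm f s t θ 0 0 - f θ) + ∑ k ∈ Finset.range s,
        uStat ((((k + 1).factorial : ℝ)⁻¹) • taylorForm f s t θ (k + 1)) x θ := by
    funext x
    rw [oneSided_eq_sum_uStat hsn (hsm t ht) x θ, Finset.sum_range_succ', uStat_zero_degree]
    simp only [uStat_smul, Nat.factorial_zero, Nat.cast_one, div_eq_inv_mul]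
    ring
  rw [hfun]
  refine (eLpNorm_const_add_sum_uStat_le hP _ s _
    -- Here `25/9 = (5/3)²`, and the ratio is `2/3 = 5/3 · 2/5`.
    (a := fun k => F * (25 / 9 * R * (√(weakVar P) / √n)) * (2 / 3) ^ k) ?_).trans ?_
  · intro k hk
    have h1 := norm_taylorForm_div_le (l := k + 1) hα hR hF (hb t ht) htr hsL
      (h.trans exp_neg_one_le)
    have h2 := term_le_linear_rate (V := strongVar P) (k := k) hn
      (le_trans (by exact_mod_cast hk) hsL) (by omega) hα hR (h'.trans exp_neg_one_le)
    rw [norm_smul, norm_inv, Real.norm_eq_abs, Nat.abs_cast, ← div_eq_inv_mul]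
    calc ‖taylorForm f s t θ (k + 1)‖ / ((k + 1).factorial : ℝ) *
          (√(weakVar P) * √(strongVar P) ^ k / √(n.choose (k + 1) : ℝ))
        ≤ F * (R ^ (k + 1) * ((k + 1).factorial : ℝ) ^ (α - 1)) * (5 / 3) ^ (k + 1 + 1) *
          (√(weakVar P) * √(strongVar P) ^ k / √(n.choose (k + 1) : ℝ)) := by gcongr
      _ = F * (5 / 3) ^ (k + 1 + 1) * √(weakVar P) *
          (R ^ (k + 1) * ((k + 1).factorial : ℝ) ^ (α - 1) *
            (√(strongVar P) ^ k / √(n.choose (k + 1) : ℝ))) := by ring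
      _ ≤ F * (5 / 3) ^ (k + 1 + 1) * √(weakVar P) * (R / √n * (2 / 5) ^ k) := by gcongr
      _ = F * (25 / 9 * R * (√(weakVar P) / √n)) * ((5 / 3) ^ k * (2 / 5) ^ k) := by ring
      _ = _ := by rw [← mul_pow]; norm_num
  · refine ENNReal.ofReal_le_ofReal (add_le_add (abs_bias_le hn hα hR hF hsm hb h ht).1 ?_)
    rw [← Finset.mul_sum]
    calc F * (25 / 9 * R * (√(weakVar P) / √n)) * ∑ k ∈ Finset.range s, (2 / 3 : ℝ) ^ k
        ≤ F * (25 / 9 * R * (√(weakVar P) / √n)) * 3 := by gcongr; exact sum_two_thirds_le s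
      _ = _ := by ring

/-- Conditional risk of the linearization error of the one-sided estimator, given the pilot. -/
lemma eLpNorm_oneSided_sub_linear_le [CompleteSpace B] (hP : MemLp (fun w : B => w) 2 P)
    (hn : 1 ≤ n) (hα : 1 ≤ α) (hR : 0 < R) (hF : 0 ≤ F)
    (hsm : ∀ x ∈ Metric.closedBall (mean P) r, ContDiffAt ℝ ((⊤ : ℕ∞) : WithTop ℕ∞) f x)
    (hb : ∀ x ∈ Metric.closedBall (mean P) r, ∀ k,
      ‖iteratedFDeriv ℝ k f x‖ ≤ F * (R ^ k * (k.factorial : ℝ) ^ α))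
    (h : R * r * Real.log (Real.exp 1 * n) ^ (α - 1) ≤ (Real.exp 1)⁻¹)
    (h' : R * Real.log (Real.exp 1 * n) ^ α * √(strongVar P / n) ≤ (Real.exp 1)⁻¹)
    (ht : t ∈ Metric.closedBall (mean P) r) :
    eLpNorm (fun x : Fin n → B => oneSided f (truncLevel n) x t - f (mean P) -
        fderiv ℝ f (mean P) (sampleMean x - mean P)) 2 (Measure.pi fun _ => P) ≤
      ENNReal.ofReal (F * (2 ^ (α - 1) * (R * r / n)) +
        (F * (2 ^ (α - 1) * (250 / 9 * R ^ 2 * (√(weakVar P) * √(strongVar P) / n))) +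
          F * (2 ^ (α - 1) * (R * ((truncLevel n + 1 : ℝ) / n))) * (√(weakVar P) / √n))) := by
  set θ := mean P with hθ
  set s := truncLevel n with hs
  have hsL := truncLevel_le_log hn
  rw [← hs] at hsL
  have htr : ‖θ - t‖ ≤ r := by rw [← dist_eq_norm, dist_comm]; exact ht
  have hsn : s ≤ n := truncLevel_le hn
  have hbias := abs_bias_le hn hα hR hF hsm hb h ht
  rw [← hs] at hbias
  -- Since `s ≥ 1`, the order-one term is present and can absorb the linear term `D f(θ)`, which is
  -- itself a U-statistic of order one.
  obtain ⟨q, hq⟩ : ∃ q, s = q + 1 := ⟨s - 1, by have := one_le_truncLevel hn; omega⟩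
  let T : ∀ k : ℕ, ContinuousMultilinearMap ℝ (fun _ : Fin (k + 1) => B) ℝ := fun k =>
    match k with
    | 0 => taylorForm f s t θ 1 - iteratedFDeriv ℝ 1 f θ
    | k + 1 => (((k + 2).factorial : ℝ)⁻¹) • taylorForm f s t θ (k + 2)
  -- The order-one bound is the Taylor remainder of the derivative; in the others, `250/27 = 2 ·
  -- (5/3)³`.
  let a : ℕ → ℝ := fun k =>
    match k with
    | 0 => F * (2 ^ (α - 1) * (R * ((s + 1 : ℝ) / n))) * (√(weakVar P) / √n)
    | k + 1 => F * (2 ^ (α - 1) * (250 / 27 * R ^ 2 * (√(weakVar P) * √(strongVar P) / n))) *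
        (2 / 3) ^ k
  have hfun : (fun x : Fin n → B => oneSided f s x t - f θ -
      fderiv ℝ f θ (sampleMean x - θ)) = fun x =>
      (taylorForm f s t θ 0 0 - f θ) + ∑ k ∈ Finset.range s, uStat (T k) x θ := by
    funext x
    rw [oneSided_eq_sum_uStat hsn (hsm t ht) x θ, Finset.sum_range_succ', uStat_zero_degree, hq,
      Finset.sum_range_succ', Finset.sum_range_succ', ← hq]
    have e : fderiv ℝ f θ (sampleMean x - θ) = uStat (iteratedFDeriv ℝ 1 f θ) x θ := by
      rw [uStat_one_degree hn, iteratedFDeriv_one_apply]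
    rw [e]
    simp only [T, uStat_smul, uStat_sub, Nat.factorial_zero, Nat.factorial_one, Nat.cast_one,
      div_eq_inv_mul, zero_add]
    ring
  rw [hfun]
  refine (eLpNorm_const_add_sum_uStat_le hP _ s T (a := a) ?_).trans ?_
  · intro k hk
    match k with
    | 0 =>
      simp only [T, a, pow_zero, mul_one, zero_add, Nat.choose_one_right]
      gcongr
      exact hbias.2
    | k + 1 =>
      have h1 := norm_taylorForm_div_le (l := k + 2) hα hR hF (hb t ht) htr hsL
        (h.trans exp_neg_one_le)
      have h2 := term_le_quadratic_rate (V := strongVar P) (k := k) hn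
        (le_trans (by exact_mod_cast hk) hsL) (by omega) hα hR (h'.trans exp_neg_one_le)
      simp only [T, a]
      rw [norm_smul, norm_inv, Real.norm_eq_abs, Nat.abs_cast, ← div_eq_inv_mul]
      calc ‖taylorForm f s t θ (k + 2)‖ / ((k + 2).factorial : ℝ) *
            (√(weakVar P) * √(strongVar P) ^ (k + 1) / √(n.choose (k + 2) : ℝ))
          ≤ F * (R ^ (k + 2) * ((k + 2).factorial : ℝ) ^ (α - 1)) * (5 / 3) ^ (k + 2 + 1) *
            (√(weakVar P) * √(strongVar P) ^ (k + 1) / √(n.choose (k + 2) : ℝ)) := by gcongr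
        _ = F * (5 / 3) ^ (k + 2 + 1) * √(weakVar P) *
            (R ^ (k + 2) * ((k + 2).factorial : ℝ) ^ (α - 1) *
              (√(strongVar P) ^ (k + 1) / √(n.choose (k + 2) : ℝ))) := by ring
        _ ≤ F * (5 / 3) ^ (k + 2 + 1) * √(weakVar P) *
            (2 ^ (α - 1) * (2 * R ^ 2 * (√(strongVar P) / n) * (2 / 5) ^ k)) := by gcongr
        _ = F * (2 ^ (α - 1) * (250 / 27 * R ^ 2 * (√(weakVar P) * √(strongVar P) / n))) *
            ((5 / 3) ^ k * (2 / 5) ^ k) := by ring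
        _ = _ := by rw [← mul_pow]; norm_num
  · refine ENNReal.ofReal_le_ofReal (add_le_add hbias.1 ?_)
    rw [hq, Finset.sum_range_succ', ← hq]
    simp only [a]
    gcongr
    rw [← Finset.mul_sum]
    calc F * (2 ^ (α - 1) * (250 / 27 * R ^ 2 * (√(weakVar P) * √(strongVar P) / n))) *
          ∑ k ∈ Finset.range q, (2 / 3 : ℝ) ^ k
        ≤ F * (2 ^ (α - 1) * (250 / 27 * R ^ 2 * (√(weakVar P) * √(strongVar P) / n))) * 3 := by
          gcongr; exact sum_two_thirds_le q
      _ = _ := by ring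

end Conditional

/-! ### From a fixed pilot to the cross-fitted estimator -/

section CrossFitting

lemma eLpNorm_two_le_iff {X : Type*} [MeasurableSpace X] {μ : Measure X} {h : X → ℝ}
    {K : ENNReal} : eLpNorm h 2 μ ≤ K ↔ ∫⁻ x, ‖h x‖ₑ ^ 2 ∂μ ≤ K ^ 2 := by
  rw [eLpNorm_eq_lintegral_rpow_enorm_toReal (by simp) (by simp)]
  simp only [ENNReal.toReal_ofNat, ENNReal.rpow_two, one_div]
  rw [ENNReal.rpow_inv_le_iff (by norm_num), ENNReal.rpow_two]

/-- Conditioning on the pilot in Fubini form: a bound uniform in the frozen variable survives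
averaging over a probability measure. -/
lemma eLpNorm_two_prod_le {X Y : Type*} [MeasurableSpace X] [MeasurableSpace Y]
    {μ : Measure X} {ν : Measure Y} [SFinite μ] [IsProbabilityMeasure ν] {h : X × Y → ℝ}
    (hm : AEStronglyMeasurable h (μ.prod ν)) {K : ENNReal}
    (hb : ∀ y, eLpNorm (fun x => h (x, y)) 2 μ ≤ K) : eLpNorm h 2 (μ.prod ν) ≤ K := by
  rw [eLpNorm_two_le_iff, lintegral_prod_symm _ (hm.enorm.pow_const 2)]
  calc ∫⁻ y, ∫⁻ x, ‖h (x, y)‖ₑ ^ 2 ∂μ ∂ν ≤ ∫⁻ _, K ^ 2 ∂ν :=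
        lintegral_mono fun y => eLpNorm_two_le_iff.1 (hb y)
    _ = K ^ 2 := by simp

/-- The estimator is known to be continuous only for pilots in the ball, and `f` is arbitrary away
from `U`. Extension by zero off a closed set is still Borel. -/
lemma aestronglyMeasurable_indicator_comp {X Y : Type*} [TopologicalSpace X]
    [TopologicalSpace.PseudoMetrizableSpace X] [MeasurableSpace Y] {ν : Measure Y} {u : Y → X}
    (hu : AEStronglyMeasurable u ν) {A : Set X} (hA : IsClosed A) {H : X → ℝ}
    (hH : ContinuousOn H A) : AEStronglyMeasurable (fun y => A.indicator H (u y)) ν := by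
  classical
  borelize X
  have hmeas : Measurable (A.indicator H) := by
    rw [← Set.piecewise_eq_indicator]
    exact hH.measurable_piecewise continuousOn_const hA.measurableSet
  exact (hmeas.comp_aemeasurable hu.aemeasurable).aestronglyMeasurable

lemma measurePreserving_halves {B : Type*} [MeasurableSpace B] {P : Measure B}
    [IsProbabilityMeasure P] {n : ℕ} :
    MeasurePreserving (fun w : Fin (n + n) → B => (firstHalf w, secondHalf w))
      (Measure.pi fun _ : Fin (n + n) => P)
      ((Measure.pi fun _ : Fin n => P).prod (Measure.pi fun _ : Fin n => P)) :=
  (measurePreserving_sumPiEquivProdPi (fun _ : Fin n ⊕ Fin n => P)).comp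
    (measurePreserving_precomp (P := P) finSumFinEquiv.injective)

lemma hasLaw_halves {B : Type*} [MeasurableSpace B] {P : Measure B} [IsProbabilityMeasure P]
    {n : ℕ} {Ω : Type*} [MeasurableSpace Ω] {μ : Measure Ω} [IsProbabilityMeasure μ]
    {W : Fin (n + n) → Ω → B} (hW : ∀ i, HasLaw (W i) P μ) (hind : iIndepFun W μ) :
    HasLaw (fun ω => (firstHalf fun i => W i ω, secondHalf fun i => W i ω))
      ((Measure.pi fun _ : Fin n => P).prod (Measure.pi fun _ : Fin n => P)) μ := by
  have h1 := (iIndepFun_iff_map_fun_eq_pi_map fun i => (hW i).aemeasurable).1 hind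
  simp only [fun i => (hW i).map_eq] at h1
  have hm : AEMeasurable (fun ω i => W i ω) μ :=
    aemeasurable_pi_lambda _ fun i => (hW i).aemeasurable
  have hp := measurePreserving_halves (B := B) (P := P) (n := n)
  refine ⟨hp.measurable.comp_aemeasurable hm, ?_⟩
  rw [← hp.map_eq, ← h1, AEMeasurable.map_map_of_aemeasurable hp.measurable.aemeasurable hm]
  rfl

variable {B : Type*} [NormedAddCommGroup B] [MeasurableSpace B]
  {P : Measure B} [IsProbabilityMeasure P] {n : ℕ}

/-- Risk of a one-sided quantity, computed from one sample with an independent pilot. -/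
lemma eLpNorm_pilot_le (hP : MemLp (fun w : B => w) 2 P) {θ : B} {r : ℝ}
    {H : (Fin n → B) → B → ℝ}
    (hH : ContinuousOn (fun z : (Fin n → B) × B => H z.1 z.2) {z | z.2 ∈ Metric.closedBall θ r})
    {K : ENNReal}
    (hK : ∀ t ∈ Metric.closedBall θ r, eLpNorm (fun x => H x t) 2 (Measure.pi fun _ => P) ≤ K)
    {g : (Fin n → B) → B} (hg : AEStronglyMeasurable g (Measure.pi fun _ : Fin n => P)) :
    AEStronglyMeasurable (fun z : (Fin n → B) × (Fin n → B) =>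
        {y | g y ∈ Metric.closedBall θ r}.indicator (fun y => H z.1 (g y)) z.2)
        ((Measure.pi fun _ : Fin n => P).prod (Measure.pi fun _ : Fin n => P)) ∧
      eLpNorm (fun z : (Fin n → B) × (Fin n → B) =>
        {y | g y ∈ Metric.closedBall θ r}.indicator (fun y => H z.1 (g y)) z.2) 2
        ((Measure.pi fun _ : Fin n => P).prod (Measure.pi fun _ : Fin n => P)) ≤ K := by
  have hm : AEStronglyMeasurable (fun z : (Fin n → B) × (Fin n → B) =>
        {y | g y ∈ Metric.closedBall θ r}.indicator (fun y => H z.1 (g y)) z.2)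
        ((Measure.pi fun _ : Fin n => P).prod (Measure.pi fun _ : Fin n => P)) := by
    have hu : AEStronglyMeasurable (fun z : (Fin n → B) × (Fin n → B) => (z.1, g z.2))
        ((Measure.pi fun _ : Fin n => P).prod (Measure.pi fun _ : Fin n => P)) :=
      (aestronglyMeasurable_sample hP n).comp_fst.prodMk hg.comp_snd
    exact aestronglyMeasurable_indicator_comp hu
      (Metric.isClosed_closedBall.preimage continuous_snd) hH
  refine ⟨hm, eLpNorm_two_prod_le hm fun y => ?_⟩
  by_cases hy : g y ∈ Metric.closedBall θ r
  · simp only [Set.indicator, Set.mem_ofPred_eq, hy, if_true]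
    exact hK _ hy
  · simp only [Set.indicator, Set.mem_ofPred_eq, hy, if_false]
    simp

/-- Risk of a cross-fitted quantity on the pilot event. -/
lemma eLpNorm_crossFit_le (hP : MemLp (fun w : B => w) 2 P)
    {Ω : Type*} [MeasurableSpace Ω] {μ : Measure Ω} [IsProbabilityMeasure μ]
    {W : Fin (n + n) → Ω → B} (hW : ∀ i, HasLaw (W i) P μ) (hind : iIndepFun W μ)
    {θ : B} {r : ℝ} {H : (Fin n → B) → B → ℝ}
    (hH : ContinuousOn (fun z : (Fin n → B) × B => H z.1 z.2) {z | z.2 ∈ Metric.closedBall θ r})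
    {K : ℝ} (hK : ∀ t ∈ Metric.closedBall θ r,
      eLpNorm (fun x => H x t) 2 (Measure.pi fun _ => P) ≤ ENNReal.ofReal K)
    {g₁ g₂ : (Fin n → B) → B} (hg₁ : AEStronglyMeasurable g₁ (Measure.pi fun _ : Fin n => P))
    (hg₂ : AEStronglyMeasurable g₂ (Measure.pi fun _ : Fin n => P)) :
    AEStronglyMeasurable ((pilotEvent g₁ g₂ W θ r).indicator fun ω =>
        (H (firstHalf fun i => W i ω) (g₂ (secondHalf fun i => W i ω)) +
          H (secondHalf fun i => W i ω) (g₁ (firstHalf fun i => W i ω))) / 2) μ ∧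
      eLpNorm ((pilotEvent g₁ g₂ W θ r).indicator fun ω =>
        (H (firstHalf fun i => W i ω) (g₂ (secondHalf fun i => W i ω)) +
          H (secondHalf fun i => W i ω) (g₁ (firstHalf fun i => W i ω))) / 2) 2 μ ≤
        ENNReal.ofReal K := by
  have hlaw := hasLaw_halves hW hind
  -- The product law is invariant under exchanging the halves, so one one-sided bound serves both
  -- terms.
  have hlaw' : HasLaw (fun ω => (secondHalf fun i => W i ω, firstHalf fun i => W i ω))
      ((Measure.pi fun _ : Fin n => P).prod (Measure.pi fun _ : Fin n => P)) μ :=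
    Measure.measurePreserving_swap.hasLaw.comp hlaw
  obtain ⟨m₂, b₂⟩ := eLpNorm_pilot_le hP hH hK hg₂
  obtain ⟨m₁, b₁⟩ := eLpNorm_pilot_le hP hH hK hg₁
  set h₁ : (Fin n → B) × (Fin n → B) → ℝ := fun z =>
    {y | g₁ y ∈ Metric.closedBall θ r}.indicator (fun y => H z.1 (g₁ y)) z.2 with hh₁
  set h₂ : (Fin n → B) × (Fin n → B) → ℝ := fun z =>
    {y | g₂ y ∈ Metric.closedBall θ r}.indicator (fun y => H z.1 (g₂ y)) z.2 with hh₂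
  set Z : Ω → (Fin n → B) × (Fin n → B) := fun ω =>
    (firstHalf fun i => W i ω, secondHalf fun i => W i ω) with hZ
  set Z' : Ω → (Fin n → B) × (Fin n → B) := fun ω =>
    (secondHalf fun i => W i ω, firstHalf fun i => W i ω) with hZ'
  rw [← hlaw.map_eq] at m₂ b₂
  rw [← hlaw'.map_eq] at m₁ b₁
  rw [eLpNorm_map_measure m₂ hlaw.aemeasurable] at b₂
  rw [eLpNorm_map_measure m₁ hlaw'.aemeasurable] at b₁
  have k₂ := m₂.comp_aemeasurable hlaw.aemeasurable
  have k₁ := m₁.comp_aemeasurable hlaw'.aemeasurable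
  have hE : NullMeasurableSet (pilotEvent g₁ g₂ W θ r) μ := by
    have a₁ : AEStronglyMeasurable (fun ω => g₁ (Z ω).1) μ := by
      refine AEStronglyMeasurable.comp_aemeasurable (f := Z) (g := fun z => g₁ z.1) ?_
        hlaw.aemeasurable
      rw [hlaw.map_eq]
      exact hg₁.comp_fst
    have a₂ : AEStronglyMeasurable (fun ω => g₂ (Z ω).2) μ := by
      refine AEStronglyMeasurable.comp_aemeasurable (f := Z) (g := fun z => g₂ z.2) ?_
        hlaw.aemeasurable
      rw [hlaw.map_eq]
      exact hg₂.comp_snd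
    exact nullMeasurableSet_le
      (((a₁.sub aestronglyMeasurable_const).norm.aemeasurable).max
        ((a₂.sub aestronglyMeasurable_const).norm.aemeasurable)) aemeasurable_const
  -- On the joint event each term equals its version truncated by its own pilot alone; only these
  -- truncations are functions to which the one-sided bound applies.
  have heq : ((pilotEvent g₁ g₂ W θ r).indicator fun ω =>
        (H (firstHalf fun i => W i ω) (g₂ (secondHalf fun i => W i ω)) +
          H (secondHalf fun i => W i ω) (g₁ (firstHalf fun i => W i ω))) / 2) =
      (pilotEvent g₁ g₂ W θ r).indicator ((1 / 2 : ℝ) • (h₂ ∘ Z + h₁ ∘ Z')) := by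
    refine Set.indicator_congr fun ω hω => ?_
    have h1 : g₁ (firstHalf fun i => W i ω) ∈ Metric.closedBall θ r := by
      rw [mem_closedBall_iff_norm]; exact (le_max_left _ _).trans hω
    have h2 : g₂ (secondHalf fun i => W i ω) ∈ Metric.closedBall θ r := by
      rw [mem_closedBall_iff_norm]; exact (le_max_right _ _).trans hω
    simp only [hh₁, hh₂, hZ, hZ', Pi.smul_apply, Pi.add_apply, Function.comp, Set.indicator,
      Set.mem_ofPred_eq, h1, h2, if_true, smul_eq_mul]
    ring
  rw [heq]
  refine ⟨((k₂.add k₁).const_smul _).indicator₀ hE, ?_⟩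
  refine (eLpNorm_indicator_le _).trans ?_
  rw [eLpNorm_const_smul]
  calc ‖(1 / 2 : ℝ)‖ₑ * eLpNorm (h₂ ∘ Z + h₁ ∘ Z') 2 μ
      ≤ ‖(1 / 2 : ℝ)‖ₑ * (ENNReal.ofReal K + ENNReal.ofReal K) := by
        gcongr
        exact (eLpNorm_add_le k₂ k₁ (by norm_num)).trans (add_le_add b₂ b₁)
    _ = ENNReal.ofReal K := by
        rw [← two_mul, ← mul_assoc, Real.enorm_eq_ofReal (by norm_num),
          show (2 : ENNReal) = ENNReal.ofReal 2 by simp, ← ENNReal.ofReal_mul (by norm_num)]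
        norm_num

end CrossFitting

/-! ### Joint continuity in sample and pilot, needed for measurability -/

section Continuity

variable {B : Type*} [NormedAddCommGroup B] [NormedSpace ℝ B] {n : ℕ}

lemma continuousOn_oneSided {f : B → ℝ} {θ : B} {r : ℝ} (s : ℕ)
    (hsm : ∀ x ∈ Metric.closedBall θ r, ContDiffAt ℝ ((⊤ : ℕ∞) : WithTop ℕ∞) f x) :
    ContinuousOn (fun z : (Fin n → B) × B => oneSided f s z.1 z.2)
      {z | z.2 ∈ Metric.closedBall θ r} := by
  intro z hz
  refine ContinuousAt.continuousWithinAt ?_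
  have hf := hsm z.2 hz
  have h0 : ContinuousAt (fun z : (Fin n → B) × B => f z.2) z :=
    ContinuousAt.comp (f := Prod.snd) (g := f) hf.continuousAt continuousAt_snd
  have hk : ∀ k, ContinuousAt (fun z : (Fin n → B) × B => iteratedFDeriv ℝ k f z.2) z := fun k =>
    ContinuousAt.comp (f := Prod.snd) (g := iteratedFDeriv ℝ k f)
      (hf.continuousAt_iteratedFDeriv (by exact_mod_cast le_top)) continuousAt_snd
  refine h0.add (tendsto_finsetSum _ fun k _ => ?_)
  refine ContinuousAt.div_const (ContinuousAt.mul continuousAt_const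
    (tendsto_finsetSum _ fun j _ => ?_)) _
  exact (hk k).eval (by fun_prop)

lemma continuous_sampleMean : Continuous (sampleMean : (Fin n → B) → B) := by
  unfold sampleMean
  fun_prop

end Continuity

/-! ### Numerical constants, and assembly of the two bounds -/

section Main

variable {B : Type*} [NormedAddCommGroup B] [NormedSpace ℝ B]

lemma norm_iteratedFDeriv_le_gevreyNorm {α R : ℝ} (hR : 0 < R) {U : Set B} {f : B → ℝ}
    (h : gevreyNorm α R U f < ⊤) {x : B} (hx : x ∈ U) (k : ℕ) :
    ‖iteratedFDeriv ℝ k f x‖ ≤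
      (gevreyNorm α R U f).toReal * (R ^ k * (k.factorial : ℝ) ^ α) := by
  have h1 : ENNReal.ofReal (‖iteratedFDeriv ℝ k f x‖ / (R ^ k * (k.factorial : ℝ) ^ α)) ≤
      gevreyNorm α R U f :=
    le_iSup₂_of_le x hx (le_iSup (fun k : ℕ =>
      ENNReal.ofReal (‖iteratedFDeriv ℝ k f x‖ / (R ^ k * (k.factorial : ℝ) ^ α))) k)
  have hk : (0 : ℝ) < k.factorial := by exact_mod_cast k.factorial_pos
  rwa [ENNReal.ofReal_le_iff_le_toReal h.ne, div_le_iff₀ (by positivity)] at h1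

lemma sampleMean_eq_halves {n : ℕ} (w : Fin (n + n) → B) :
    sampleMean w = (2 : ℝ)⁻¹ • (sampleMean (firstHalf w) + sampleMean (secondHalf w)) := by
  simp only [sampleMean, firstHalf, secondHalf, Fin.sum_univ_add, ← smul_add, smul_smul]
  congr 1
  push_cast
  rw [← two_mul, mul_inv]

lemma err_bound {α R F ν r : ℝ} {n : ℕ} (hR : 0 < R) (hF : 0 ≤ F) (hr : 0 < r)
    (hα : 1 ≤ α) :
    F * (2 ^ (α - 1) * (R * r / n)) + F * (25 / 3 * R * (√ν / √n)) ≤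
      30 * 2 ^ α * max R (R ^ 2) * F * (√(ν / n) + r / n) := by
  rw [Real.sqrt_div' ν (Nat.cast_nonneg n), Real.rpow_sub_one (by norm_num)]
  have hp : (1 : ℝ) ≤ 2 ^ α := Real.one_le_rpow (by norm_num) (by linarith)
  set p : ℝ := 2 ^ α
  have hM : R ≤ max R (R ^ 2) := le_max_left _ _
  set M := max R (R ^ 2)
  calc F * (p / 2 * (R * r / n)) + F * (25 / 3 * R * (√ν / √n))
      = p * R * F * (1 / 2 * (r / n)) + 1 * R * F * (25 / 3 * (√ν / √n)) := by ring
    _ ≤ p * M * F * (30 * (r / n)) + p * M * F * (30 * (√ν / √n)) := by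
        gcongr <;> norm_num
    _ = _ := by ring

/-- After multiplication by `√(2n)`, the bias gives `r/√n`, the orders from two on give `√(νV/n)`,
and the order-one remainder gives `√ν n^(-3/4)`. The constant is `30 = 3/2 · 20`, from `√2 ≤ 3/2`
and `125/9 ≤ 20`. -/
lemma dev_bound {α R F ν V r : ℝ} {n : ℕ} (hn : 1 ≤ n) (hR : 0 < R) (hF : 0 ≤ F)
    (hr : 0 < r) (hν : 0 ≤ ν) :
    √(2 * n : ℝ) * (F * (2 ^ (α - 1) * (R * r / n)) +
        (F * (2 ^ (α - 1) * (250 / 9 * R ^ 2 * (√ν * √V / n))) +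
          F * (2 ^ (α - 1) * (R * ((truncLevel n + 1 : ℝ) / n))) * (√ν / √n))) ≤
      30 * 2 ^ α * max R (R ^ 2) * F *
        (√(ν * V / n) + r / √n + √ν / (n : ℝ) ^ (3 / 4 : ℝ)) := by
  have hn0 : (0 : ℝ) < n := by exact_mod_cast hn
  have h2 : √(2 : ℝ) ≤ 3 / 2 := by
    rw [Real.sqrt_le_left (by norm_num)]; norm_num
  have hs := truncLevel_succ_le hn
  have hquarter : (n : ℝ) ^ (1 / 4 : ℝ) / n = 1 / (n : ℝ) ^ (3 / 4 : ℝ) := by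
    rw [div_eq_div_iff hn0.ne' (by positivity), ← Real.rpow_add hn0]
    norm_num
  have hs' : (truncLevel n + 1 : ℝ) / n ≤ 6 * (1 / (n : ℝ) ^ (3 / 4 : ℝ)) := by
    rw [← hquarter, ← mul_div_assoc]
    gcongr
  rw [Real.sqrt_mul (by norm_num), Real.sqrt_div' (ν * V) (Nat.cast_nonneg n), Real.sqrt_mul hν,
    Real.rpow_sub_one (by norm_num)]
  have hp : (0 : ℝ) ≤ 2 ^ α := by positivity
  set p : ℝ := 2 ^ α
  have hM : R ≤ max R (R ^ 2) := le_max_left _ _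
  have hM2 : R ^ 2 ≤ max R (R ^ 2) := le_max_right _ _
  set M := max R (R ^ 2)
  set y := √(n : ℝ) with hy
  have hy0 : 0 < y := Real.sqrt_pos.2 hn0
  have hyn : (n : ℝ) = y * y := (Real.mul_self_sqrt hn0.le).symm
  have e1 : y * (r / n) = r / y := by rw [hyn]; field_simp
  have e2 : y * (√ν * √V / n) = √ν * √V / y := by rw [hyn]; field_simp
  calc √2 * y * (F * (p / 2 * (R * r / n)) +
        (F * (p / 2 * (250 / 9 * R ^ 2 * (√ν * √V / n))) +
          F * (p / 2 * (R * ((truncLevel n + 1 : ℝ) / n))) * (√ν / y)))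
      = √2 * (p * R * F * (1 / 2) * (y * (r / n)) +
          (p * R ^ 2 * F * (125 / 9) * (y * (√ν * √V / n)) +
            p * R * F * (1 / 2) * (((truncLevel n + 1 : ℝ) / n) * √ν))) := by
        field_simp
        ring
    _ ≤ 3 / 2 * (p * M * F * 20 * (r / y) + (p * M * F * 20 * (√ν * √V / y) +
          p * M * F * (1 / 2) * ((6 * (1 / (n : ℝ) ^ (3 / 4 : ℝ))) * √ν))) := by
        rw [e1, e2]
        gcongr <;> norm_num
    _ = 30 * p * M * F * (r / y) + (30 * p * M * F * (√ν * √V / y) +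
          9 / 2 * (p * M * F * (√ν / (n : ℝ) ^ (3 / 4 : ℝ)))) := by ring
    _ ≤ 30 * p * M * F * (r / y) + (30 * p * M * F * (√ν * √V / y) +
          30 * (p * M * F * (√ν / (n : ℝ) ^ (3 / 4 : ℝ)))) := by
        gcongr
        norm_num
    _ = _ := by ring

end Main

end GevreyEst

theorem mainTheorem4 :
    ∃ C : ℝ, 0 < C ∧
      ∀ (B : Type*) [NormedAddCommGroup B] [NormedSpace ℝ B] [CompleteSpace B]
        [MeasurableSpace B] [BorelSpace B]
        (Ω : Type*) [MeasurableSpace Ω] (μ : Measure Ω) [IsProbabilityMeasure μ]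
        (P : Measure B) [IsProbabilityMeasure P] (_ : MemLp (fun w : B => w) 2 P)
        (n : ℕ) (_ : 1 ≤ n)
        (W : Fin (n + n) → Ω → B) (_ : ∀ i, HasLaw (W i) P μ) (_ : iIndepFun W μ)
        (g₁ g₂ : (Fin n → B) → B)
        (_ : AEStronglyMeasurable g₁ (Measure.pi fun _ : Fin n => P))
        (_ : AEStronglyMeasurable g₂ (Measure.pi fun _ : Fin n => P))
        (α R r : ℝ) (_ : 1 ≤ α) (_ : 0 < R) (_ : 0 < r)
        (U : Set B) (_ : Metric.closedBall (GevreyEst.mean P) r ⊆ U)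
        (f : B → ℝ) (_ : f ∈ GevreyEst.gevreyClass α U)
        (_ : GevreyEst.gevreyNorm α R U f < ⊤)
        (_ : max (R * r * Real.log (Real.exp 1 * n) ^ (α - 1))
            (R * Real.log (Real.exp 1 * n) ^ α * √(GevreyEst.strongVar P / n))
            ≤ (Real.exp 1)⁻¹),
        let θ : B := GevreyEst.mean P
        let ν : ℝ := GevreyEst.weakVar P
        let V : ℝ := GevreyEst.strongVar P
        let F : ℝ := (GevreyEst.gevreyNorm α R U f).toReal
        let E : Set Ω := GevreyEst.pilotEvent g₁ g₂ W θ r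
        let fhat : Ω → ℝ := fun ω =>
          GevreyEst.crossFit f (GevreyEst.truncLevel n) g₁ g₂ (fun i => W i ω)
        let err : Ω → ℝ := E.indicator fun ω => |fhat ω - f θ| ^ 2
        let dev : Ω → ℝ := E.indicator fun ω => (2 * n : ℝ) *
          (fhat ω - f θ - fderiv ℝ f θ (GevreyEst.sampleMean (fun i => W i ω) - θ)) ^ 2
        (Integrable err μ ∧
          √(∫ ω, err ω ∂μ) ≤ C * 2 ^ α * max R (R ^ 2) * F * (√(ν / n) + r / n)) ∧
        (Integrable dev μ ∧
          √(∫ ω, dev ω ∂μ) ≤ C * 2 ^ α * max R (R ^ 2) * F *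
            (√(ν * V / n) + r / √n + √ν / (n : ℝ) ^ (3 / 4 : ℝ))) := by
  refine ⟨30, by norm_num, ?_⟩
  intro B _ _ _ _ _ Ω _ μ _ P _ hP n hn W hW hind g₁ g₂ hg₁ hg₂ α R r hα hR hr U hU f hf hfin
    hmax θ ν V F E fhat err dev
  have h := (le_max_left _ _).trans hmax
  have h' := (le_max_right _ _).trans hmax
  have hF : 0 ≤ F := ENNReal.toReal_nonneg
  have hν : 0 ≤ ν := Real.iSup_nonneg fun u => integral_nonneg fun w => by positivity
  have hsm : ∀ x ∈ Metric.closedBall θ r, ContDiffAt ℝ ((⊤ : ℕ∞) : WithTop ℕ∞) f x :=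
    fun x hx => hf.1 x (hU hx)
  have hb : ∀ x ∈ Metric.closedBall θ r, ∀ k,
      ‖iteratedFDeriv ℝ k f x‖ ≤ F * (R ^ k * (k.factorial : ℝ) ^ α) :=
    fun x hx k => GevreyEst.norm_iteratedFDeriv_le_gevreyNorm hR hfin (hU hx) k
  have hcont := GevreyEst.continuousOn_oneSided (n := n) (GevreyEst.truncLevel n) hsm
  constructor
  · obtain ⟨hm, hle⟩ := GevreyEst.eLpNorm_crossFit_le hP hW hind
      (H := fun x t => GevreyEst.oneSided f (GevreyEst.truncLevel n) x t - f θ)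
      (hcont.sub continuousOn_const)
      (fun t ht => GevreyEst.eLpNorm_oneSided_sub_le hP hn hα hR hF hsm hb h h' ht) hg₁ hg₂
    have key := GevreyEst.integrable_sq_of_eLpNorm_le hm (by positivity)
      (hle.trans (ENNReal.ofReal_le_ofReal (GevreyEst.err_bound (n := n) hR hF hr hα)))
    -- The error of the average is the average of the one-sided errors, and squaring commutes with
    -- the indicator.
    have herr : err = fun ω => (E.indicator (fun ω =>
        (GevreyEst.oneSided f (GevreyEst.truncLevel n) (GevreyEst.firstHalf fun i => W i ω)
            (g₂ (GevreyEst.secondHalf fun i => W i ω)) - f θ +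
          (GevreyEst.oneSided f (GevreyEst.truncLevel n) (GevreyEst.secondHalf fun i => W i ω)
            (g₁ (GevreyEst.firstHalf fun i => W i ω)) - f θ)) / 2) ω) ^ 2 := by
      funext ω
      by_cases hω : ω ∈ E
      · simp only [err, Set.indicator_of_mem hω, sq_abs, fhat, GevreyEst.crossFit]
        ring
      · simp only [err, Set.indicator_of_notMem hω]
        norm_num
    rw [herr]
    exact key
  -- The factor `N = 2n` is carried as `√(2n)` inside the one-sided quantity, so that its square
  -- reproduces `dev`.
  · have hcont' : ContinuousOn (fun z : (Fin n → B) × B => √(2 * n : ℝ) *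
        (GevreyEst.oneSided f (GevreyEst.truncLevel n) z.1 z.2 - f θ -
          fderiv ℝ f θ (GevreyEst.sampleMean z.1 - θ))) {z | z.2 ∈ Metric.closedBall θ r} :=
      continuousOn_const.mul ((hcont.sub continuousOn_const).sub
        (((fderiv ℝ f θ).continuous.comp ((GevreyEst.continuous_sampleMean.comp
          continuous_fst).sub continuous_const)).continuousOn))
    obtain ⟨hm, hle⟩ := GevreyEst.eLpNorm_crossFit_le hP hW hind
      (H := fun x t => √(2 * n : ℝ) *
        (GevreyEst.oneSided f (GevreyEst.truncLevel n) x t - f θ -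
          fderiv ℝ f θ (GevreyEst.sampleMean x - θ))) hcont'
      (fun t ht => by
        have hlin := GevreyEst.eLpNorm_oneSided_sub_linear_le hP hn hα hR hF hsm hb h h' ht
        have hc := eLpNorm_const_smul (√(2 * n : ℝ)) (fun x : Fin n → B =>
          GevreyEst.oneSided f (GevreyEst.truncLevel n) x t - f θ -
            fderiv ℝ f θ (GevreyEst.sampleMean x - θ)) 2 (Measure.pi fun _ => P)
        refine le_of_eq_of_le hc ?_
        refine (mul_le_mul_right hlin _).trans ?_
        rw [Real.enorm_eq_ofReal (Real.sqrt_nonneg _), ← ENNReal.ofReal_mul (Real.sqrt_nonneg _)])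
      hg₁ hg₂
    have key := GevreyEst.integrable_sq_of_eLpNorm_le hm (by positivity)
      (hle.trans (ENNReal.ofReal_le_ofReal (GevreyEst.dev_bound hn hR hF hr hν)))
    -- The full sample mean is the average of the two half means, so the linear term splits and the
    -- linearization error is again of cross-fitted form.
    have hdev : dev = fun ω => (E.indicator (fun ω =>
        (√(2 * n : ℝ) * (GevreyEst.oneSided f (GevreyEst.truncLevel n)
            (GevreyEst.firstHalf fun i => W i ω) (g₂ (GevreyEst.secondHalf fun i => W i ω)) -
              f θ - fderiv ℝ f θ (GevreyEst.sampleMean (GevreyEst.firstHalf fun i => W i ω) - θ)) +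
          √(2 * n : ℝ) * (GevreyEst.oneSided f (GevreyEst.truncLevel n)
            (GevreyEst.secondHalf fun i => W i ω) (g₁ (GevreyEst.firstHalf fun i => W i ω)) -
              f θ - fderiv ℝ f θ
                (GevreyEst.sampleMean (GevreyEst.secondHalf fun i => W i ω) - θ))) / 2) ω) ^ 2 := by
      funext ω
      by_cases hω : ω ∈ E
      · simp only [dev, Set.indicator_of_mem hω, fhat, GevreyEst.crossFit,
          GevreyEst.sampleMean_eq_halves, map_sub, map_smul, map_add, smul_eq_mul]
        rw [← mul_add, mul_div_assoc, mul_pow, Real.sq_sqrt (by positivity)]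
        ring
      · simp only [dev, Set.indicator_of_notMem hω]
        norm_num
    rw [hdev]
    exact key
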